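/- Let $K$ be a number field, $w$ a finite place of $K$, and $F=K_w$, with normalized absolute value $|\cdot|$, valuation $v$ (with $v(0)=\infty$), ring of integers $\mathcal{O}_F$, uniformizer $\varpi$, and $q=|\varpi|^{-1}$ the cardinality of the residue field. Let $\psi:F\to\mathbb{C}^\times$ be a nontrivial continuous unitary additive character (for example the standard one). Let $\mathcal{V}(F)=\mathfrak{gl}_2(F)\times F\times F$ and $\mathcal{V}'(F)=\mathfrak{gl}_2(F)\times F^\times\times F^\times$. For $\alpha=(B,y_1,y_2)$ and $v=(T,t_1,t_2)$ in $\mathcal{V}(F)$ put $\langle\alpha,v\rangle=\mathrm{tr}(BT)+y_1t_1+y_2t_2$; write $B=(b_{ij})$ and $|B|=\max_{i,j}|b_{ij}|$. Fix a Haar measure on $F$, let $dv=dT\,dt_1\,dt_2$ be the product measure on $\mathcal{V}(F)$, and let $dt^\times$ be a Haar measure on $F^\times$. Let $f_1,f_2\in C_c^\infty(\mathfrak{gl}_2(F))$ (locally constant, compactly supported, complex-valued). For $b\in F^\times$, $\alpha\in\mathcal{V}(F)$, a continuous unitary character $\chi$ of $F^\times$, and $s\in\mathbb{C}$ consider $$I(b,\alpha,\chi,s)=\int_{F^\times}\left(\int_{\mathcal{V}(F)}f_1(T)\,f_2\begin{pmatrix}-t_1&\frac{b\det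 T-t_1t_2}{t}\\ t&t_2\end{pmatrix}\psi\left(\frac{\langle\alpha,v\rangle}{t}\right)dv\right)\chi(t)|t|^s\,dt^\times .$$ The absolute norm of the conductor of $\chi$ is $q^{c(\chi)}$, where $c(\chi)$ is the least $k\ge0$ such that $\chi$ is trivial on $\{u\in\mathcal{O}_F^\times: u\equiv1 \bmod \varpi^k\}$. (1) For all $b\in F^\times$ and $\alpha\in\mathcal{V}(F)$ the inner integral over $\mathcal{V}(F)$ converges absolutely for every $t\in F^\times$. For every $\chi$ and every $s$ with $\mathrm{Re}(s)>0$, the integral of $$f_1(T)\,f_2\begin{pmatrix}-t_1&\frac{b\det T-t_1t_2}{t}\\ t&t_2\end{pmatrix}\psi\left(\frac{\langle\alpha,v\rangle}{t}\right)\chi(t)|t|^s$$ over $F^\times\times\mathcal{V}(F)$ with respect to $dt^\times\,dv$ converges absolutely. (2) There are a constant $C$ and an integer $m\ge0$, depending only on $f_1,f_2,|b|$ and $w$ (and on the fixed $\psi$ and measures), such that for all $\alpha=(B,y_1,y_2)\in\mathcal{V}'(F)$, all $\chi$, and all $s$ with $\sigma:=\mathrm{Re}(s)>-3$, the integral over $F^\times$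 defining $I(b,\alpha,\chi,s)$ converges absolutely and $$|I(b,\alpha,\chi,s)|\le C\,q^{m\max(0,\sigma)}\left(1+q^{-\sigma}+q^{6\min(v(b_{ij}),v(y_i))}\sum_{n=2}^\infty q^{-n(3+\sigma)}\right),$$ where the minimum is over all of the six valuations $v(b_{ij})$, $v(y_i)$. (3) There is a constant $R$, depending only on $f_1,f_2,|b|$ and $w$ (and on the fixed $\psi$ and measures), such that $I(b,\alpha,\chi,s)=0$ whenever $|y_1|>R$, or $|y_2|>R$, or $|B|>R$, or the absolute norm of the conductor of $\chi$ exceeds $R$; here $s$ and $\alpha=(B,y_1,y_2)$ satisfy either $\mathrm{Re}(s)>0$ and $\alpha\in\mathcal{V}(F)$, or $\mathrm{Re}(s)>-3$ and $\alpha\in\mathcal{V}'(F)$. -/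

import Mathlib

open MeasureTheory IsDedekindDomain
open scoped NumberField

noncomputable section

namespace RamifiedOrbital

/-- The points `𝒱(F) = 𝔤𝔩₂(F) × F × F`; an element `(T, t₁, t₂)` is `v` with
`T = v.1`, `t₁ = v.2.1`, `t₂ = v.2.2`. -/
abbrev V (F : Type*) : Type _ := (Fin 2 → Fin 2 → F) × F × F

section Field

variable {F : Type*}

/-- The matrix part of a point of `𝒱(F)`. -/
def V.mat (v : V F) : Matrix (Fin 2) (Fin 2) F := Matrix.of v.1

/-- The pairing `⟨(B, y₁, y₂), (T, t₁, t₂)⟩ = tr (B T) + y₁ t₁ + y₂ t₂`. -/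
def pairing [Field F] (α v : V F) : F :=
  (α.mat * v.mat).trace + α.2.1 * v.2.1 + α.2.2 * v.2.2

/-- The matrix `(-t₁, (b det T - t₁ t₂) / t ; t, t₂)` attached to `v = (T, t₁, t₂)` and `t`. -/
def cellMatrix [Field F] (b t : F) (v : V F) : Matrix (Fin 2) (Fin 2) F :=
  !![-v.2.1, (b * v.mat.det - v.2.1 * v.2.2) / t; t, v.2.2]

/-- The open subset `𝒱'(F) = 𝔤𝔩₂(F) × Fˣ × Fˣ` of `𝒱(F)`. -/
def V' (F : Type*) [Field F] : Set (V F) := {α | α.2.1 ≠ 0 ∧ α.2.2 ≠ 0}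

/-- The space `C_c^∞(𝔤𝔩₂(F))` of locally constant compactly supported functions. -/
def IsTestFunction [TopologicalSpace F] (f : Matrix (Fin 2) (Fin 2) F → ℂ) : Prop :=
  IsLocallyConstant f ∧ HasCompactSupport f

/-- The norm `|B| = max |b_ij|` of the matrix part `B` of a point of `𝒱(F)`. -/
def matNorm [NormedField F] (α : V F) : ℝ :=
  max (max ‖α.1 0 0‖ ‖α.1 0 1‖) (max ‖α.1 1 0‖ ‖α.1 1 1‖)

/-- The measure `dv = dT dt₁ dt₂` on `𝒱(F)` built from a measure on `F`. -/
def volV [MeasurableSpace F] (μ : Measure F) : Measure (V F) :=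
  (Measure.pi fun _ => Measure.pi fun _ => μ).prod (μ.prod μ)

/-- The function `f₁(T) f₂(-t₁, (b det T - t₁ t₂) / t ; t, t₂) ψ(⟨α, v⟩ / t)` of `v` and `t`. -/
def kernel [Field F] (ψ : AddChar F Circle) (f₁ f₂ : Matrix (Fin 2) (Fin 2) F → ℂ) (b : F)
    (α : V F) (t : Fˣ) (v : V F) : ℂ :=
  f₁ v.mat * f₂ (cellMatrix b (t : F) v) * (ψ (pairing α v / (t : F)) : ℂ)

/-- The quasi-character `t ↦ χ(t) |t|^s`. -/
def twist [NormedField F] (χ : Fˣ → Circle) (s : ℂ) (t : Fˣ) : ℂ :=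
  (χ t : ℂ) * ((‖(t : F)‖ : ℝ) : ℂ) ^ s

/-- The integrand over `t ∈ Fˣ` : the inner integral over `𝒱(F)`, times `χ(t) |t|^s`. -/
def outerIntegrand [NormedField F] [MeasurableSpace F] (μ : Measure F) (ψ : AddChar F Circle)
    (f₁ f₂ : Matrix (Fin 2) (Fin 2) F → ℂ) (b : F) (α : V F) (χ : Fˣ → Circle) (s : ℂ)
    (t : Fˣ) : ℂ :=
  (∫ v, kernel ψ f₁ f₂ b α t v ∂(volV μ)) * twist χ s t

/-- The Mellin transformed local orbital integral. -/
def orbitalMellin [NormedField F] [MeasurableSpace F] (μ : Measure F) (ν : Measure Fˣ)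
    (ψ : AddChar F Circle) (f₁ f₂ : Matrix (Fin 2) (Fin 2) F → ℂ) (b : F) (α : V F)
    (χ : Fˣ → Circle) (s : ℂ) : ℂ :=
  ∫ t, outerIntegrand μ ψ f₁ f₂ b α χ s t ∂ν

end Field

section Place

variable {K : Type*} [Field K] [NumberField K] (w : HeightOneSpectrum (𝓞 K))

/-- The cardinality `q = |ϖ|⁻¹` of the residue field at `w`. -/
def q : ℕ := Ideal.absNorm w.asIdeal

/-- The additive valuation of the completion `K_w`, with value `⊤` at `0`. -/
def ord (x : w.adicCompletion K) : WithTop ℤ :=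
  open Classical in if x = 0 then ⊤ else ((-WithZero.log (Valued.v x) : ℤ) : WithTop ℤ)

/-- The minimum of the valuations of the six coordinates `b_ij`, `y_i` of `α`. -/
def minOrd (α : V (w.adicCompletion K)) : WithTop ℤ :=
  min (min (min (ord w (α.1 0 0)) (ord w (α.1 0 1))) (min (ord w (α.1 1 0)) (ord w (α.1 1 1))))
    (min (ord w α.2.1) (ord w α.2.2))

/-- The groups `𝒪ˣ(ϖ^k)` : the units that are `1` modulo `ϖ^k`
(for `k = 0`, all units of the ring of integers). -/
def unitFiltration (k : ℕ) : Set (w.adicCompletion K)ˣ :=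
  {u | ‖(u : w.adicCompletion K)‖ = 1 ∧
    ‖(u : w.adicCompletion K) - 1‖ ≤ ((q w : ℝ) ^ k)⁻¹}

/-- The exponent of the conductor of `χ` : the least `k` with `χ` trivial on `𝒪ˣ(ϖ^k)`. -/
def conductorExponent (χ : (w.adicCompletion K)ˣ →* Circle) : ℕ :=
  sInf {k : ℕ | ∀ u ∈ unitFiltration w k, χ u = 1}

/-- The absolute norm of the conductor of `χ`. -/
def conductorNorm (χ : (w.adicCompletion K)ˣ →* Circle) : ℝ := (q w : ℝ) ^ conductorExponent w χ

/-- The quantity `1 + q^{-σ} + q^{6 min(v(b_ij), v(y_i))} ∑_{n ≥ 2} q^{-n(3+σ)}`, for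
`α = (B, y₁, y₂)` other than `0`. -/
def majorant (α : V (w.adicCompletion K)) (σ : ℝ) : ℝ :=
  1 + (q w : ℝ) ^ (-σ) +
    (q w : ℝ) ^ (6 * (minOrd w α).untopD 0) * ∑' n : ℕ, (q w : ℝ) ^ (-((n : ℝ) + 2) * (3 + σ))

end Place

end RamifiedOrbital

end

set_option linter.unusedSectionVars false

noncomputable section

namespace RamifiedOrbital

/-! The functions `f₁`, `f₂` are bounded, supported in a ball of radius `M` and invariant under
translations of size `δ`. Since `-t₁`, `t` and `t₂` are entries of the cell matrix, the kernel lives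
on `|v|, |t| ≤ M`. Hence the inner integral `J(t)` is bounded, and absolute convergence for `Re s >
0` reduces to that of `|t|^σ` near `0`.

Vanishing comes from two symmetries. Translating `v` by `k` of size `O(|t|)` leaves `f₁` and `f₂`
unchanged and multiplies the kernel by `ψ(⟨α, k⟩ / t)`; with `k = O(t)` this phase can be made
nontrivial once `|α|` is large, uniformly in `t` (`exists_innerIntegral_eq_zero`). Scaling `(t, v)`
by a unit `u` near `1` fixes `J`, so the Mellin transform is multiplied by `χ(u)` and vanishes for
highly ramified `χ` (`orbitalMellin_eq_zero_of_unit`).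

Continuation to `Re s > -3` rests on `|J(t)| ≪ |t|³ / |α|³` (`exists_innerIntegral_mul_pow_le`). By
linearity `f₁`, `f₂` may be indicators of balls. The only nonlinear condition, on the entry `(b det
T - t₁ t₂) / t`, is expanded by Fourier inversion as an integral over a frequency `η`. For fixed `η`
the form `b det T - t₁ t₂` splits into three hyperbolic planes, and each planar oscillatory integral
is `O(|t| / |η|)`. It also vanishes unless the matching coordinates of `α` are `O(|t|)` or `O(|η|)`.
So either `|α| ≪ |t|`, where the trivial bound suffices, or `|η| ≫ |α|` on the support, which gives
`|t|³ / |α|³`.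

As `α` is bounded when `J ≠ 0`, `|α|⁻³` may be replaced by a multiple of `|α|⁻⁶`, which is `q` to
six times the minimal valuation. The trivial bound on `q⁻¹ ≤ |t| ≤ q^N` gives the terms `1 +
q^{-σ}`, and decay on the shells `|t| = q^{-n}`, `n ≥ 2`, gives the geometric series. -/

/-- `ϖ` generates the maximal ideal of a nonarchimedean field `F` whose absolute value is
normalized by `|ϖ|⁻¹ = Q`, the cardinality of the residue field. -/
structure IsNormalizedUniformizer {F : Type*} [NormedField F] (Q : ℕ) (ϖ : F) : Prop where
  one_lt : 1 < Q
  norm_eq : ‖ϖ‖ = (Q : ℝ)⁻¹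
  exists_norm_eq_zpow : ∀ x : F, x ≠ 0 → ∃ n : ℤ, ‖x‖ = (Q : ℝ) ^ n
  exists_residues : ∃ S : Finset F, S.card = Q ∧ (∀ s ∈ S, ‖s‖ ≤ 1) ∧
    (∀ s ∈ S, ∀ s' ∈ S, s ≠ s' → ‖s - s'‖ = 1) ∧ ∀ x : F, ‖x‖ ≤ 1 → ∃ s ∈ S, ‖x - s‖ ≤ ‖ϖ‖

/-! ### Elementary properties of the normalized absolute value -/

section Uniformizer

variable {F : Type*} [NormedField F] {Q : ℕ} {ϖ : F}

namespace IsNormalizedUniformizer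

lemma one_lt_cast (h : IsNormalizedUniformizer Q ϖ) : (1 : ℝ) < Q := by exact_mod_cast h.one_lt

lemma cast_pos (h : IsNormalizedUniformizer Q ϖ) : (0 : ℝ) < Q := by linarith [h.one_lt_cast]

lemma ne_zero (h : IsNormalizedUniformizer Q ϖ) : ϖ ≠ 0 := by
  rw [← norm_ne_zero_iff, h.norm_eq]; exact inv_ne_zero h.cast_pos.ne'

lemma norm_lt_one (h : IsNormalizedUniformizer Q ϖ) : ‖ϖ‖ < 1 := by
  rw [h.norm_eq]; exact inv_lt_one_of_one_lt₀ h.one_lt_cast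

lemma norm_zpow_neg (h : IsNormalizedUniformizer Q ϖ) (n : ℤ) : ‖ϖ ^ (-n)‖ = (Q : ℝ) ^ n := by
  rw [norm_zpow, h.norm_eq, inv_zpow', neg_neg]

lemma exists_norm_le (h : IsNormalizedUniformizer Q ϖ) {ε : ℝ} (hε : 0 < ε) :
    ∃ d : F, d ≠ 0 ∧ ‖d‖ ≤ ε := by
  obtain ⟨n, hn⟩ := exists_pow_lt_of_lt_one hε h.norm_lt_one
  exact ⟨ϖ ^ n, pow_ne_zero _ h.ne_zero, by rw [norm_pow]; exact hn.le⟩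

end IsNormalizedUniformizer

end Uniformizer

/-! ### Haar measure of balls -/

section Measure

variable {F : Type*} [NormedField F] [IsUltrametricDist F] [ProperSpace F] [MeasurableSpace F]
  [BorelSpace F] {Q : ℕ} {ϖ : F}

lemma closedBall_eq_iUnion (h : IsNormalizedUniformizer Q ϖ) {S : Finset F}
    (hS1 : ∀ s ∈ S, ‖s‖ ≤ 1) (hS : ∀ x : F, ‖x‖ ≤ 1 → ∃ s ∈ S, ‖x - s‖ ≤ ‖ϖ‖) {c : F}
    (hc : c ≠ 0) :
    Metric.closedBall (0 : F) ‖c‖ = ⋃ s ∈ S, Metric.closedBall (c * s) ‖ϖ * c‖ := by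
  ext x
  simp only [Metric.mem_closedBall, dist_zero_right, Set.mem_iUnion, exists_prop]
  simp only [dist_eq_norm]
  have hc' : 0 < ‖c‖ := norm_pos_iff.2 hc
  constructor
  · intro hx
    obtain ⟨s, hs, hxs⟩ := hS (x / c) (by rw [norm_div]; exact div_le_one_of_le₀ hx hc'.le)
    refine ⟨s, hs, ?_⟩
    have : x - c * s = c * (x / c - s) := by field_simp
    rw [this, norm_mul, norm_mul, mul_comm]
    gcongr
  · rintro ⟨s, hs, hxs⟩
    have : x = (x - c * s) + c * s := by ring
    rw [this]
    refine (IsUltrametricDist.norm_add_le_max (x - c * s) (c * s)).trans (max_le (hxs.trans ?_) ?_)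
    · rw [norm_mul]; exact mul_le_of_le_one_left hc'.le h.norm_lt_one.le
    · rw [norm_mul]; exact mul_le_of_le_one_right hc'.le (hS1 s hs)

lemma measureReal_closedBall_center (μ : Measure F) [μ.IsAddHaarMeasure] (x : F) (r : ℝ) :
    μ.real (Metric.closedBall x r) = μ.real (Metric.closedBall 0 r) := by
  rw [measureReal_def, measureReal_def, Measure.addHaar_closedBall_center]

/-- The residue classes cut the ball into `Q` disjoint translates of the next smaller ball. -/
lemma measureReal_closedBall_zero_norm (h : IsNormalizedUniformizer Q ϖ) (μ : Measure F)
    [μ.IsAddHaarMeasure] {c : F} (hc : c ≠ 0) :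
    μ.real (Metric.closedBall 0 ‖c‖) = Q * μ.real (Metric.closedBall 0 ‖ϖ * c‖) := by
  obtain ⟨S, hcard, hS1, hS2, hS⟩ := h.exists_residues
  rw [closedBall_eq_iUnion h hS1 hS hc, measureReal_biUnion_finset (h := fun s _ => (isCompact_closedBall _ _).measure_lt_top.ne)]
  · simp [measureReal_closedBall_center, hcard]
  · intro s hs s' hs' hss'
    rw [Function.onFun, Set.disjoint_left]
    intro x hx hx'
    rw [Metric.mem_closedBall, dist_eq_norm] at hx hx'
    have h1 : c * (s - s') = (x - c * s') - (x - c * s) := by ring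
    have h2 : ‖c * (s - s')‖ ≤ ‖ϖ * c‖ := by
      rw [h1]
      rw [sub_eq_add_neg]
      exact (IsUltrametricDist.norm_add_le_max _ _).trans (max_le hx' (by rwa [norm_neg]))
    rw [norm_mul, norm_mul, hS2 s hs s' hs' hss', mul_one] at h2
    have := norm_pos_iff.2 hc
    nlinarith [h.norm_lt_one]
  · intro s _; exact measurableSet_closedBall

lemma measureReal_closedBall (h : IsNormalizedUniformizer Q ϖ) (μ : Measure F)
    [μ.IsAddHaarMeasure] (x : F) {c : F} (hc : c ≠ 0) :
    μ.real (Metric.closedBall x ‖c‖) = ‖c‖ * μ.real (Metric.closedBall 0 1) := by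
  have hQ := h.cast_pos.ne'
  have step : ∀ n : ℤ, μ.real (Metric.closedBall 0 ((Q : ℝ) ^ (n + 1))) =
      Q * μ.real (Metric.closedBall 0 ((Q : ℝ) ^ n)) := by
    intro n
    have := measureReal_closedBall_zero_norm h μ (zpow_ne_zero (-(n + 1)) h.ne_zero)
    rwa [norm_mul, h.norm_zpow_neg, h.norm_eq, zpow_add₀ hQ, zpow_one, mul_comm _ (Q : ℝ),
      inv_mul_cancel_left₀ hQ, mul_comm (Q : ℝ), ← zpow_add_one₀ hQ] at this
  have key : ∀ n : ℤ, μ.real (Metric.closedBall 0 ((Q : ℝ) ^ n)) =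
      (Q : ℝ) ^ n * μ.real (Metric.closedBall 0 1) := by
    intro n
    induction n with
    | zero => simp
    | succ n ih => rw [step, ih, zpow_add_one₀ hQ]; ring
    | pred n ih =>
      have := step (-n - 1)
      rw [sub_add_cancel, ih] at this
      rw [zpow_sub_one₀ hQ (-(n : ℤ)), mul_right_comm, this, mul_comm (Q : ℝ),
        mul_inv_cancel_right₀ hQ, ← zpow_sub_one₀ hQ]
  obtain ⟨n, hn⟩ := h.exists_norm_eq_zpow c hc
  rw [measureReal_closedBall_center, hn, key]

lemma measureReal_closedBall_pos (μ : Measure F) [μ.IsAddHaarMeasure] :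
    0 < μ.real (Metric.closedBall (0 : F) 1) := by
  rw [measureReal_def, ENNReal.toReal_pos_iff]
  exact ⟨Metric.measure_closedBall_pos μ 0 one_pos, (isCompact_closedBall _ _).measure_lt_top⟩

/-- An isomorphism of groups matching the measures of one ball matches Haar measures. -/
lemma measurePreserving_of_measure_preimage_closedBall {E E' : Type*} [NormedAddCommGroup E]
    [MeasurableSpace E] [BorelSpace E] [NormedAddCommGroup E']
    [ProperSpace E'] [MeasurableSpace E'] [BorelSpace E'] (μ : Measure E) [μ.IsAddHaarMeasure]
    (μ' : Measure E') [μ'.IsAddHaarMeasure] (e : E ≃ₜ+ E')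
    (he : μ (e ⁻¹' Metric.closedBall 0 1) = μ' (Metric.closedBall 0 1)) :
    MeasurePreserving e μ μ' := by
  refine ⟨e.continuous.measurable, ?_⟩
  have : (μ.map e).IsAddHaarMeasure := e.isAddHaarMeasure_map μ
  have h1 := Measure.isAddLeftInvariant_eq_smul (μ.map e) μ'
  have hm : Measurable e := e.continuous.measurable
  rw [← Measure.map_apply hm Metric.isClosed_closedBall.measurableSet, h1, Measure.smul_apply,
    ENNReal.smul_def, smul_eq_mul] at he
  have hpos := Metric.measure_closedBall_pos μ' (0 : E') one_pos
  have hfin : μ' (Metric.closedBall (0 : E') 1) ≠ ⊤ := (isCompact_closedBall _ _).measure_lt_top.ne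
  have h3 : ((μ.map e).addHaarScalarFactor μ' : ENNReal) = 1 := by
    conv_rhs at he => rw [← one_mul (μ' _)]
    exact (ENNReal.mul_left_inj hpos.ne' hfin).1 he
  have h4 : (μ.map e).addHaarScalarFactor μ' = 1 := by exact_mod_cast h3
  rw [h1, h4, one_smul]

/-- Multiplication by a scalar of absolute value one preserves Haar measures. -/
lemma measurePreserving_unit_smul {E : Type*} [NormedAddCommGroup E] [NormedSpace F E]
    [ProperSpace E] [MeasurableSpace E] [BorelSpace E] (μ : Measure E) [μ.IsAddHaarMeasure]
    {u : F} (hu : ‖u‖ = 1) : MeasurePreserving (fun x : E => u • x) μ μ := by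
  have hu0 : u ≠ 0 := by rintro rfl; simp at hu
  let e : E ≃ₜ+ E :=
    { DistribMulAction.toAddEquiv₀ E u hu0 with
      continuous_toFun := continuous_const_smul u
      continuous_invFun := continuous_const_smul u⁻¹ }
  have he : ∀ x, e x = u • x := fun _ => rfl
  refine measurePreserving_of_measure_preimage_closedBall μ μ e (congrArg μ ?_)
  ext x
  simp [he, norm_smul, hu]

end Measure

/-! ### Additive characters and their conductors -/

section Character

/-- Squaring expands distances to `1` near `1`; this is the quantitative form of the circle having
no small subgroups. -/
lemma three_halves_mul_norm_sub_one_le {z : ℂ} (hz : ‖z - 1‖ ≤ 1 / 2) :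
    3 / 2 * ‖z - 1‖ ≤ ‖z ^ 2 - 1‖ := by
  have h1 : z ^ 2 - 1 = (2 + (z - 1)) * (z - 1) := by ring
  have h2 : ‖(2 : ℂ)‖ - ‖z - 1‖ ≤ ‖2 + (z - 1)‖ := by
    have := norm_sub_norm_le (2 : ℂ) (-(z - 1))
    rwa [norm_neg, sub_neg_eq_add] at this
  rw [Complex.norm_two] at h2
  rw [h1, norm_mul]
  gcongr
  linarith

lemma integral_eq_zero_of_add_right {E : Type*} [AddGroup E] [MeasurableSpace E]
    [MeasurableAdd₂ E] (μ : Measure E) [μ.IsAddRightInvariant] {f : E → ℂ} {h : E} {ζ : ℂ}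
    (hf : ∀ x, f (x + h) = ζ * f x) (hζ : ζ ≠ 1) : ∫ x, f x ∂μ = 0 := by
  have h1 : ∫ x, f (x + h) ∂μ = ∫ x, f x ∂μ := integral_add_right_eq_self f h
  simp_rw [hf, integral_const_mul] at h1
  have : (ζ - 1) * ∫ x, f x ∂μ = 0 := by rw [sub_mul, h1]; ring
  exact (mul_eq_zero.1 this).resolve_left (sub_ne_zero.2 hζ)

variable {F : Type*} [NormedField F] [IsUltrametricDist F] {Q : ℕ} {ϖ : F}

/-- A nontrivial continuous additive character has a conductor. -/
lemma exists_conductor (h : IsNormalizedUniformizer Q ϖ) (ψ : AddChar F Circle)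
    (hψ : Continuous ψ) (hψ1 : ψ ≠ 1) :
    ∃ a : F, a ≠ 0 ∧ ∀ x : F, (∀ y : F, ‖y‖ ≤ 1 → ψ (y * x) = 1) ↔ ‖x‖ ≤ ‖a‖ := by
  have hQ := h.one_lt_cast
  let P : ℤ → Prop := fun n => ∀ x : F, ‖x‖ ≤ (Q : ℝ) ^ (-n) → ψ x = 1
  have hex : ∃ n, P n := by
    have hc : Continuous fun x => ‖(ψ x : ℂ) - 1‖ := by fun_prop
    obtain ⟨ε, hε, hball⟩ := Metric.isOpen_iff.1 (isOpen_lt hc (continuous_const (y := (1 / 2 : ℝ))))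
      0 (by simp)
    obtain ⟨n, hn⟩ := exists_pow_lt_of_lt_one hε h.norm_lt_one
    refine ⟨n, fun x hx => ?_⟩
    have hxε : ‖x‖ < ε := by
      refine hx.trans_lt ?_
      rwa [zpow_neg, zpow_natCast, ← inv_pow, ← h.norm_eq]
    -- All `2 ^ k * x` stay in the small ball, because `|2| ≤ 1`. If `ψ x ≠ 1`, repeated squaring
    -- would push their values out of the half-disc around `1`.
    have hsmall : ∀ k : ℕ, ‖(2 : F) ^ k * x‖ < ε := by
      intro k
      refine lt_of_le_of_lt ?_ hxε
      rw [norm_mul, norm_pow]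
      have h2 : ‖(2 : F)‖ ≤ 1 := by
        simpa using IsUltrametricDist.norm_natCast_le_one F 2
      exact mul_le_of_le_one_left (norm_nonneg _) (pow_le_one₀ (norm_nonneg _) h2)
    have hsmall' : ∀ k : ℕ, ‖(ψ ((2 : F) ^ k * x) : ℂ) - 1‖ < 1 / 2 := fun k =>
      hball (by simpa using hsmall k)
    have hgrow : ∀ k : ℕ, (3 / 2 : ℝ) ^ k * ‖(ψ x : ℂ) - 1‖ ≤ ‖(ψ ((2 : F) ^ k * x) : ℂ) - 1‖ := by
      intro k
      induction k with
      | zero => simp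
      | succ k ih =>
        have h3 : ψ ((2 : F) ^ (k + 1) * x) = ψ ((2 : F) ^ k * x) ^ 2 := by
          rw [← AddChar.map_nsmul_eq_pow]
          congr 1
          simp [pow_succ]; ring
        rw [h3, pow_succ', mul_assoc, Circle.coe_pow]
        exact (mul_le_mul_of_nonneg_left ih (by norm_num)).trans
          (three_halves_mul_norm_sub_one_le (hsmall' k).le)
    by_contra hne
    have hpos : 0 < ‖(ψ x : ℂ) - 1‖ := by
      rw [norm_pos_iff, sub_ne_zero]
      exact fun h1 => hne (Circle.ext (by simpa using h1))
    obtain ⟨k, hk⟩ := pow_unbounded_of_one_lt (1 / ‖(ψ x : ℂ) - 1‖) (show (1 : ℝ) < 3 / 2 by norm_num)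
    rw [div_lt_iff₀ hpos] at hk
    linarith [hgrow k, hsmall' k]
  have hbdd : ∃ b : ℤ, ∀ n, P n → b ≤ n := by
    obtain ⟨x, hx⟩ : ∃ x, ψ x ≠ 1 := by
      by_contra! hx
      exact hψ1 (by ext x; simp [hx])
    have hx0 : x ≠ 0 := by rintro rfl; simp at hx
    obtain ⟨n, hn⟩ := h.exists_norm_eq_zpow x hx0
    refine ⟨-n, fun m hm => ?_⟩
    by_contra! hlt
    exact hx (hm x (hn ▸ zpow_le_zpow_right₀ hQ.le (by lia)))
  obtain ⟨b, hb⟩ := hbdd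
  -- The largest ball on which `ψ` is trivial has radius `Q ^ (-n)` for the least admissible `n`; so
  -- `a = ϖ ^ n`.
  obtain ⟨n, hn, hmin⟩ := Int.exists_least_of_bdd ⟨b, hb⟩ hex
  refine ⟨ϖ ^ n, zpow_ne_zero _ h.ne_zero, fun x => ?_⟩
  have hϖ : ‖ϖ ^ n‖ = (Q : ℝ) ^ (-n) := by simpa using h.norm_zpow_neg (-n)
  rw [hϖ]
  constructor
  · intro hx
    rcases eq_or_ne x 0 with rfl | hx0
    · simp; positivity
    obtain ⟨m, hm⟩ := h.exists_norm_eq_zpow x hx0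
    have : P (-m) := by
      intro y hy
      have : y = (y / x) * x := by field_simp
      rw [this]
      apply hx
      rw [norm_div, hm]
      rw [neg_neg] at hy
      exact div_le_one_of_le₀ hy (by positivity)
    rw [hm]
    exact zpow_le_zpow_right₀ hQ.le (by linarith [hmin _ this])
  · intro hx y hy
    apply hn
    rw [norm_mul]
    exact (mul_le_of_le_one_left (norm_nonneg _) hy).trans hx

end Character

/-! ### Oscillatory integrals over balls and hyperbolic planes -/

section Oscillatory

variable {F : Type*} [NormedField F] [IsUltrametricDist F] [ProperSpace F] [MeasurableSpace F]
  [BorelSpace F] {Q : ℕ} {ϖ : F}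

/-- The character `ψ` is trivial on `x𝒪` exactly when `|x| ≤ |a|`. -/
def IsConductor (ψ : AddChar F Circle) (a : F) : Prop :=
  ∀ x : F, (∀ y : F, ‖y‖ ≤ 1 → ψ (y * x) = 1) ↔ ‖x‖ ≤ ‖a‖

lemma add_mem_closedBall_iff {E : Type*} [SeminormedAddCommGroup E] [IsUltrametricDist E]
    {x₀ x h : E} {r : ℝ} (hh : ‖h‖ ≤ r) :
    x + h ∈ Metric.closedBall x₀ r ↔ x ∈ Metric.closedBall x₀ r := by
  rw [Metric.mem_closedBall, Metric.mem_closedBall, dist_eq_norm, dist_eq_norm]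
  constructor <;> intro hx
  · have : x - x₀ = (x + h - x₀) + -h := by abel
    rw [this]
    exact (IsUltrametricDist.norm_add_le_max _ _).trans (max_le hx (by rwa [norm_neg]))
  · have : x + h - x₀ = (x - x₀) + h := by abel
    rw [this]
    exact (IsUltrametricDist.norm_add_le_max _ _).trans (max_le hx hh)

lemma norm_integral_closedBall_char_le (μ : Measure F) [μ.IsAddHaarMeasure]
    (ψ : AddChar F Circle) (g : F → F) (x₀ : F) (r : ℝ) :
    ‖∫ x in Metric.closedBall x₀ r, (ψ (g x) : ℂ) ∂μ‖ ≤ μ.real (Metric.closedBall 0 r) := by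
  refine (norm_setIntegral_le_of_norm_le_const (C := 1)
    (isCompact_closedBall _ _).measure_lt_top fun x _ => (Circle.norm_coe _).le).trans ?_
  rw [one_mul, measureReal_closedBall_center]

/-- The ball is stable under translation by `y * d` with `|y| ≤ 1`, and some such translation
multiplies the integrand by a constant other than `1`. -/
lemma integral_closedBall_char_eq_zero (μ : Measure F) [μ.IsAddHaarMeasure]
    {ψ : AddChar F Circle} {a : F} (ha : IsConductor ψ a) (x₀ d β γ : F)
    (hβ : ¬ ‖d * β‖ ≤ ‖a‖) :
    ∫ x in Metric.closedBall x₀ ‖d‖, (ψ (x * β + γ) : ℂ) ∂μ = 0 := by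
  rw [← ha] at hβ
  push Not at hβ
  obtain ⟨y, hy, hψ⟩ := hβ
  rw [← integral_indicator Metric.isClosed_closedBall.measurableSet]
  refine integral_eq_zero_of_add_right μ (h := y * d) (ζ := ψ (y * (d * β))) (fun x => ?_) ?_
  · have hh : ‖y * d‖ ≤ ‖d‖ := by
      rw [norm_mul]; exact mul_le_of_le_one_left (norm_nonneg _) hy
    by_cases hx : x ∈ Metric.closedBall x₀ ‖d‖
    · rw [Set.indicator_of_mem hx, Set.indicator_of_mem ((add_mem_closedBall_iff hh).2 hx),
        ← Circle.coe_mul, ← AddChar.map_add_eq_mul]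
      congr 2
      ring
    · rw [Set.indicator_of_notMem hx,
        Set.indicator_of_notMem (fun h' => hx ((add_mem_closedBall_iff hh).1 h')), mul_zero]
  · exact fun h1 => hψ (Circle.ext (by simpa using h1))

/-- The Fourier expansion of the indicator function of a ball. -/
lemma integral_unitBall_char (μ : Measure F) [μ.IsAddHaarMeasure] {ψ : AddChar F Circle} {a : F}
    (ha : IsConductor ψ a) (x : F) :
    ∫ y in Metric.closedBall 0 1, (ψ (y * x) : ℂ) ∂μ =
      if ‖x‖ ≤ ‖a‖ then (μ.real (Metric.closedBall (0 : F) 1) : ℂ) else 0 := by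
  split_ifs with hx
  · rw [setIntegral_congr_fun (g := fun _ => (1 : ℂ)) Metric.isClosed_closedBall.measurableSet]
    · simp
    · intro y hy
      have := (ha x).2 hx y (by simpa using hy)
      simp [this]
  · have := integral_closedBall_char_eq_zero μ ha 0 1 x 0 (by simpa using hx)
    simpa using this

/-- The integral over a ball of a character of a hyperbolic quadratic polynomial in two
variables. -/
def hyperbolicIntegral (μ : Measure F) (ψ : AddChar F Circle) (x₀ z₀ : F) (r : ℝ) (κ β γ : F) : ℂ :=
  ∫ p in Metric.closedBall x₀ r ×ˢ Metric.closedBall z₀ r,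
    (ψ (κ * p.1 * p.2 + β * p.1 + γ * p.2) : ℂ) ∂(μ.prod μ)

lemma hyperbolicIntegral_eq (μ : Measure F) [μ.IsAddHaarMeasure] {ψ : AddChar F Circle}
    (hψ : Continuous ψ) (x₀ z₀ : F) (r : ℝ) (κ β γ : F) :
    hyperbolicIntegral μ ψ x₀ z₀ r κ β γ = ∫ x in Metric.closedBall x₀ r,
      ∫ z in Metric.closedBall z₀ r, (ψ (z * (κ * x + γ) + β * x) : ℂ) ∂μ ∂μ := by
  rw [hyperbolicIntegral, setIntegral_prod]
  · simp only [show ∀ x z : F, κ * x * z + β * x + γ * z = z * (κ * x + γ) + β * x by intros; ring]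
  · refine ContinuousOn.integrableOn_compact
      ((isCompact_closedBall _ _).prod (isCompact_closedBall _ _)) ?_
    fun_prop

lemma hyperbolicIntegral_swap (μ : Measure F) [μ.IsAddHaarMeasure] {ψ : AddChar F Circle}
    (x₀ z₀ : F) (r : ℝ) (κ β γ : F) :
    hyperbolicIntegral μ ψ x₀ z₀ r κ β γ = hyperbolicIntegral μ ψ z₀ x₀ r κ γ β := by
  rw [hyperbolicIntegral, hyperbolicIntegral,
    ← setIntegral_prod_swap _ _ fun p : F × F => (ψ (κ * p.1 * p.2 + β * p.1 + γ * p.2) : ℂ)]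
  simp only [Prod.fst_swap, Prod.snd_swap,
    show ∀ x z : F, κ * x * z + β * x + γ * z = κ * z * x + γ * z + β * x by intros; ring]

/-- For fixed `x` the integral over `z` has linear phase with slope `κ x + γ`. It vanishes off the
ball `T` where `|d (κ x + γ)| ≤ |a|`, and is at most the volume of a ball of radius `|d|` there. In
the product of the two volumes `|d|` cancels. -/
lemma norm_hyperbolicIntegral_le (h : IsNormalizedUniformizer Q ϖ) (μ : Measure F)
    [μ.IsAddHaarMeasure] {ψ : AddChar F Circle} (hψ : Continuous ψ) {a : F} (ha0 : a ≠ 0)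
    (ha : IsConductor ψ a) (x₀ z₀ : F) {d : F} (hd : d ≠ 0) {κ : F} (hκ : κ ≠ 0) (β γ : F) :
    ‖hyperbolicIntegral μ ψ x₀ z₀ ‖d‖ κ β γ‖ ≤
      ‖a‖ * μ.real (Metric.closedBall (0 : F) 1) ^ 2 / ‖κ‖ := by
  set T : Set F := Metric.closedBall (-γ / κ) ‖a / (d * κ)‖ with hT
  have hTm : MeasurableSet T := Metric.isClosed_closedBall.measurableSet
  set g : F → ℂ := fun x =>
    ∫ z in Metric.closedBall z₀ ‖d‖, (ψ (z * (κ * x + γ) + β * x) : ℂ) ∂μ with hg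
  have hgT : g = T.indicator g := by
    ext x
    by_cases hx : x ∈ T
    · rw [Set.indicator_of_mem hx]
    · rw [Set.indicator_of_notMem hx]
      refine integral_closedBall_char_eq_zero μ ha _ _ _ _ fun hle => hx ?_
      rw [hT, Metric.mem_closedBall, dist_eq_norm]
      have : x - -γ / κ = d * (κ * x + γ) / (d * κ) := by field_simp; ring
      rw [this, norm_div, norm_div]
      gcongr
  rw [hyperbolicIntegral_eq μ hψ]
  change ‖∫ x in _, g x ∂μ‖ ≤ _
  rw [hgT, setIntegral_indicator hTm]
  have hsub : Metric.closedBall x₀ ‖d‖ ∩ T ⊆ T := Set.inter_subset_right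
  have hfin : μ T < ⊤ := (isCompact_closedBall _ _).measure_lt_top
  refine (norm_setIntegral_le_of_norm_le_const ((measure_mono hsub).trans_lt hfin)
    fun x _ => norm_integral_closedBall_char_le μ ψ _ _ _).trans ?_
  have h1 : μ.real (Metric.closedBall x₀ ‖d‖ ∩ T) ≤ μ.real T := measureReal_mono hsub hfin.ne
  have h2 : μ.real T = ‖a / (d * κ)‖ * μ.real (Metric.closedBall 0 1) :=
    measureReal_closedBall h μ _ (by positivity)
  rw [measureReal_closedBall h μ _ hd]
  rw [h2] at h1
  refine (mul_le_mul_of_nonneg_left h1 (by positivity)).trans (le_of_eq ?_)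
  have : ‖d‖ ≠ 0 := norm_ne_zero_iff.2 hd
  have : ‖κ‖ ≠ 0 := norm_ne_zero_iff.2 hκ
  rw [norm_div, norm_mul]
  field_simp

/-- A nonzero integral has some `x` in the ball with nonzero `z`-integral, so the slope `κ x + γ` is
at most `|a| / |d|`; the ultrametric inequality then isolates `γ`. -/
lemma norm_snd_coeff_le_of_hyperbolicIntegral_ne_zero (μ : Measure F) [μ.IsAddHaarMeasure]
    {ψ : AddChar F Circle} (hψ : Continuous ψ) {a : F} (ha : IsConductor ψ a) {x₀ z₀ d κ β γ : F}
    (hd : d ≠ 0) (hne : hyperbolicIntegral μ ψ x₀ z₀ ‖d‖ κ β γ ≠ 0) :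
    ‖γ‖ ≤ max (‖a‖ / ‖d‖) (‖κ‖ * max ‖x₀‖ ‖d‖) := by
  rw [hyperbolicIntegral_eq μ hψ] at hne
  obtain ⟨x, hx, hxne⟩ : ∃ x ∈ Metric.closedBall x₀ ‖d‖,
      ∫ z in Metric.closedBall z₀ ‖d‖, (ψ (z * (κ * x + γ) + β * x) : ℂ) ∂μ ≠ 0 := by
    by_contra! hall
    exact hne (setIntegral_eq_zero_of_forall_eq_zero hall)
  have hle : ‖d * (κ * x + γ)‖ ≤ ‖a‖ := by
    by_contra hlt
    exact hxne (integral_closedBall_char_eq_zero μ ha _ _ _ _ hlt)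
  have hd' : 0 < ‖d‖ := norm_pos_iff.2 hd
  have hx' : ‖x‖ ≤ max ‖x₀‖ ‖d‖ := by
    rw [Metric.mem_closedBall, dist_eq_norm] at hx
    have : x = x₀ + (x - x₀) := by ring
    rw [this]
    exact (IsUltrametricDist.norm_add_le_max _ _).trans (max_le_max le_rfl hx)
  have : γ = (κ * x + γ) + -(κ * x) := by ring
  rw [this]
  refine (IsUltrametricDist.norm_add_le_max _ _).trans (max_le_max ?_ ?_)
  · rw [le_div_iff₀ hd', mul_comm, ← norm_mul]; exact hle
  · rw [norm_neg, norm_mul]; gcongr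

lemma norm_fst_coeff_le_of_hyperbolicIntegral_ne_zero (μ : Measure F) [μ.IsAddHaarMeasure]
    {ψ : AddChar F Circle} (hψ : Continuous ψ) {a : F} (ha : IsConductor ψ a) {x₀ z₀ d κ β γ : F}
    (hd : d ≠ 0) (hne : hyperbolicIntegral μ ψ x₀ z₀ ‖d‖ κ β γ ≠ 0) :
    ‖β‖ ≤ max (‖a‖ / ‖d‖) (‖κ‖ * max ‖z₀‖ ‖d‖) := by
  rw [hyperbolicIntegral_swap] at hne
  exact norm_snd_coeff_le_of_hyperbolicIntegral_ne_zero μ hψ ha hd hne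

end Oscillatory

/-! ### Uniform local constancy of test functions -/

section TestFunction

variable {E : Type*} [NormedAddCommGroup E]

/-- A continuous function bounded by `C`, supported on the ball of radius `M` about the origin and
invariant under translation by vectors of norm at most `δ`. -/
structure IsUniformlyLocallyConstant (g : E → ℂ) (δ M C : ℝ) : Prop where
  continuous : Continuous g
  invariant : ∀ x h, ‖h‖ ≤ δ → g (x + h) = g x
  support : ∀ x, g x ≠ 0 → ‖x‖ ≤ M
  bound : ∀ x, ‖g x‖ ≤ C

lemma IsUniformlyLocallyConstant.mono {g : E → ℂ} {δ M C δ' M' C' : ℝ}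
    (hg : IsUniformlyLocallyConstant g δ M C) (hδ : δ' ≤ δ) (hM : M ≤ M') (hC : C ≤ C') :
    IsUniformlyLocallyConstant g δ' M' C' :=
  ⟨hg.continuous, fun x k hk => hg.invariant x k (hk.trans hδ),
    fun x hx => (hg.support x hx).trans hM, fun x => (hg.bound x).trans hC⟩

lemma IsUniformlyLocallyConstant.bound_nonneg {g : E → ℂ} {δ M C : ℝ}
    (hg : IsUniformlyLocallyConstant g δ M C) : 0 ≤ C := (norm_nonneg _).trans (hg.bound 0)

lemma exists_isUniformlyLocallyConstant {g : E → ℂ} (hg : IsLocallyConstant g)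
    (hc : HasCompactSupport g) : ∃ δ > 0, ∃ M C, IsUniformlyLocallyConstant g δ M C := by
  obtain ⟨δ, hδ, hball⟩ := lebesgue_number_lemma_of_metric (c := fun z : ℂ => g ⁻¹' {z}) hc
    (fun z => hg.isOpen_fiber z) (fun x _ => Set.mem_iUnion.2 ⟨g x, rfl⟩)
  obtain ⟨M, hM⟩ := hc.isBounded.exists_norm_le
  obtain ⟨C, hC⟩ := hc.exists_bound_of_continuousOn hg.continuous.continuousOn
  have key : ∀ x ∈ tsupport g, ∀ k, ‖k‖ ≤ δ / 2 → g (x + k) = g x := by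
    intro x hx k hk
    obtain ⟨z, hz⟩ := hball x hx
    have h1 : g x = z := hz (Metric.mem_ball_self hδ)
    have h2 : g (x + k) = z := hz (by
      rw [Metric.mem_ball, dist_eq_norm, add_sub_cancel_left]; linarith)
    rw [h1, h2]
  refine ⟨δ / 2, half_pos hδ, M, max C 0, hg.continuous, fun x k hk => ?_,
    fun x hx => hM x (subset_tsupport g hx), fun x => ?_⟩
  · by_cases hx : x ∈ tsupport g
    · exact key x hx k hk
    by_cases hx' : x + k ∈ tsupport g
    · have := key (x + k) hx' (-k) (by rwa [norm_neg])
      rw [add_neg_cancel_right] at this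
      exact this.symm
    · rw [image_eq_zero_of_notMem_tsupport hx, image_eq_zero_of_notMem_tsupport hx']
  · by_cases hx : x ∈ tsupport g
    · exact (hC x hx).trans (le_max_left _ _)
    · rw [image_eq_zero_of_notMem_tsupport hx, norm_zero]; exact le_max_right _ _

/-- A uniformly locally constant function is a finite combination of indicators of balls. -/
lemma IsUniformlyLocallyConstant.exists_finset [IsUltrametricDist E] [ProperSpace E] {g : E → ℂ}
    {δ M C : ℝ} (hδ : 0 < δ) (hg : IsUniformlyLocallyConstant g δ M C) :
    ∃ S : Finset E, ∀ x, g x = ∑ c ∈ S, (if ‖x - c‖ ≤ δ then g c else 0) := by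
  classical
  have htriv : ∀ x y z : E, ‖x - y‖ ≤ δ → ‖y - z‖ ≤ δ → ‖x - z‖ ≤ δ := fun x y z h1 h2 => by
    rw [← sub_add_sub_cancel x y z]
    exact (IsUltrametricDist.norm_add_le_max _ _).trans (max_le h1 h2)
  -- In an ultrametric space, being within `δ` is an equivalence relation. Replacing the centres of
  -- a finite cover by class representatives makes the balls disjoint, so each point is counted at
  -- most once.
  let s : Setoid E :=
    { r := fun x y => ‖x - y‖ ≤ δ
      iseqv := ⟨fun x => by simp [hδ.le], fun h => by rwa [norm_sub_rev], htriv _ _ _⟩ }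
  let r : E → E := fun x => (Quotient.mk s x).out
  have hr : ∀ x, ‖r x - x‖ ≤ δ := fun x => Quotient.exact (Quotient.out_eq (Quotient.mk s x))
  have hr' : ∀ x y, ‖x - y‖ ≤ δ → r x = r y := fun x y hxy => by
    have : Quotient.mk s x = Quotient.mk s y := Quotient.sound hxy
    simp only [r, this]
  obtain ⟨T, -, hT, hcov⟩ := (isCompact_closedBall (0 : E) M).finite_cover_balls hδ
  refine ⟨hT.toFinset.image r, fun x => ?_⟩
  have hgr : ∀ x c : E, ‖x - c‖ ≤ δ → g x = g c := fun x c hxc => by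
    have := hg.invariant c (x - c) hxc
    rwa [add_sub_cancel] at this
  by_cases hx : ∃ c ∈ hT.toFinset.image r, ‖x - c‖ ≤ δ
  · obtain ⟨c, hc, hxc⟩ := hx
    rw [Finset.sum_eq_single_of_mem c hc, if_pos hxc]
    · exact hgr x c hxc
    · intro c' hc' hne
      rw [if_neg]
      intro hxc'
      obtain ⟨y, -, rfl⟩ := Finset.mem_image.1 hc
      obtain ⟨y', -, rfl⟩ := Finset.mem_image.1 hc'
      apply hne
      have h1 : ‖y' - y‖ ≤ δ :=
        htriv _ _ _ (by rw [norm_sub_rev]; exact hr y')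
          (htriv _ _ _ (by rwa [norm_sub_rev]) (htriv _ _ _ hxc (hr y)))
      exact hr' _ _ h1
  · push Not at hx
    rw [Finset.sum_eq_zero fun c hc => if_neg (hx c hc).not_ge]
    by_contra hgx
    have := hcov (show x ∈ Metric.closedBall 0 M by simpa using hg.support x hgx)
    simp only [Set.mem_iUnion, exists_prop, Metric.mem_ball, dist_eq_norm] at this
    obtain ⟨y, hy, hxy⟩ := this
    exact (hx (r y) (Finset.mem_image_of_mem r (hT.mem_toFinset.2 hy))).not_ge
      (htriv _ _ _ hxy.le (by rw [norm_sub_rev]; exact hr y))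

variable {F : Type*} [NormedField F]

/-- On the support, `u • x` differs from `x` by at most `|u - 1| M ≤ δ`; off it both values vanish,
since `u` preserves norms. -/
lemma IsUniformlyLocallyConstant.unit_smul [NormedSpace F E] [IsUltrametricDist E] {g : E → ℂ}
    {δ M C : ℝ} (hg : IsUniformlyLocallyConstant g δ M C) {u : F} (hu : ‖u‖ = 1)
    (hu1 : ‖u - 1‖ * M ≤ δ) (x : E) : g (u • x) = g x := by
  by_cases hx : ‖x‖ ≤ M
  · have : u • x = x + (u - 1) • x := by rw [sub_smul, one_smul, add_sub_cancel]
    rw [this]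
    apply hg.invariant
    rw [norm_smul]
    exact (mul_le_mul_of_nonneg_left hx (norm_nonneg _)).trans hu1
  · have h1 : g x = 0 := by
      by_contra h; exact hx (hg.support x h)
    have h2 : g (u • x) = 0 := by
      by_contra h
      exact hx (by simpa [norm_smul, hu] using hg.support _ h)
    rw [h1, h2]

lemma IsTestFunction.exists_isUniformlyLocallyConstant {f : Matrix (Fin 2) (Fin 2) F → ℂ}
    (hf : IsTestFunction f) : ∃ δ > 0, ∃ M C,
      IsUniformlyLocallyConstant (fun x : Fin 2 → Fin 2 → F => f (Matrix.of x)) δ M C :=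
  RamifiedOrbital.exists_isUniformlyLocallyConstant (E := Fin 2 → Fin 2 → F) hf.1 hf.2

end TestFunction

/-! ### Continuity, size and support of the kernel -/

section Kernel

variable {F : Type*} [NormedField F]

/-- The entries of `cellMatrix b t v`. -/
def cellEntries (b t : F) (v : V F) : Fin 2 → Fin 2 → F :=
  ![![-v.2.1, (b * (v.1 0 0 * v.1 1 1 - v.1 0 1 * v.1 1 0) - v.2.1 * v.2.2) / t], ![t, v.2.2]]

lemma cellMatrix_eq (b t : F) (v : V F) : cellMatrix b t v = Matrix.of (cellEntries b t v) := by
  simp [cellMatrix, cellEntries, Matrix.det_fin_two, V.mat]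

lemma pairing_eq (α v : V F) : pairing α v =
    α.1 0 0 * v.1 0 0 + α.1 0 1 * v.1 1 0 + (α.1 1 0 * v.1 0 1 + α.1 1 1 * v.1 1 1)
      + α.2.1 * v.2.1 + α.2.2 * v.2.2 := by
  simp [pairing, V.mat, Matrix.trace_fin_two, Matrix.mul_apply, Fin.sum_univ_two]

lemma kernel_eq (ψ : AddChar F Circle) (f₁ f₂ : Matrix (Fin 2) (Fin 2) F → ℂ) (b : F) (α : V F)
    (t : Fˣ) (v : V F) : kernel ψ f₁ f₂ b α t v =
      f₁ (Matrix.of v.1) * f₂ (Matrix.of (cellEntries b t v)) * (ψ (pairing α v / t) : ℂ) := by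
  rw [kernel, cellMatrix_eq]; rfl

lemma continuous_pairing_div (α : V F) :
    Continuous fun p : Fˣ × V F => pairing α p.2 / (p.1 : F) := by
  simp only [pairing_eq]
  have : Continuous fun p : Fˣ × V F => (p.1 : F) := by fun_prop
  refine Continuous.div₀ ?_ this fun p => p.1.ne_zero
  fun_prop

lemma continuous_cellEntries (b : F) :
    Continuous fun p : Fˣ × V F => cellEntries b (p.1 : F) p.2 := by
  have h1 : Continuous fun p : Fˣ × V F => (p.1 : F) := by fun_prop
  refine continuous_pi fun i => continuous_pi fun j => ?_
  fin_cases i <;> fin_cases j <;> simp [cellEntries]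
  · fun_prop
  · exact Continuous.div₀ (by fun_prop) h1 fun p => p.1.ne_zero
  · fun_prop
  · fun_prop

lemma continuous_kernel {ψ : AddChar F Circle} (hψ : Continuous ψ)
    {f₁ f₂ : Matrix (Fin 2) (Fin 2) F → ℂ} (hf₁ : Continuous f₁) (hf₂ : Continuous f₂) (b : F)
    (α : V F) : Continuous fun p : Fˣ × V F => kernel ψ f₁ f₂ b α p.1 p.2 := by
  simp only [kernel_eq]
  refine ((hf₁.comp ?_).mul (hf₂.comp (continuous_cellEntries b))).mul
    ((by fun_prop : Continuous fun z : Circle => (z : ℂ)).comp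
      (hψ.comp (continuous_pairing_div α)))
  exact (by fun_prop : Continuous fun p : Fˣ × V F => p.2.1)

variable {ψ : AddChar F Circle} {f₁ f₂ : Matrix (Fin 2) (Fin 2) F → ℂ} {δ M C : ℝ}

lemma norm_kernel_le
    (h₁ : IsUniformlyLocallyConstant (fun x : Fin 2 → Fin 2 → F => f₁ (Matrix.of x)) δ M C)
    (h₂ : IsUniformlyLocallyConstant (fun x : Fin 2 → Fin 2 → F => f₂ (Matrix.of x)) δ M C)
    (b : F) (α : V F) (t : Fˣ) (v : V F) :
    ‖kernel ψ f₁ f₂ b α t v‖ ≤ C ^ 2 := by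
  rw [kernel_eq, norm_mul, norm_mul, Circle.norm_coe, mul_one, sq]
  exact mul_le_mul (h₁.bound v.1) (h₂.bound _) (norm_nonneg _) h₁.bound_nonneg

lemma norm_le_of_cellEntries {b t : F} {v : V F} (h₁ : ‖v.1‖ ≤ M) (h₂ : ‖cellEntries b t v‖ ≤ M) :
    ‖v‖ ≤ M ∧ ‖t‖ ≤ M := by
  have hij : ∀ i j, ‖cellEntries b t v i j‖ ≤ M := fun i j =>
    (norm_le_pi_norm _ j).trans ((norm_le_pi_norm _ i).trans h₂)
  have h00 := hij 0 0
  have h10 := hij 1 0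
  have h11 := hij 1 1
  simp [cellEntries] at h00 h10 h11
  exact ⟨max_le h₁ (max_le h00 h11), h10⟩

lemma norm_le_of_kernel_ne_zero
    (h₁ : IsUniformlyLocallyConstant (fun x : Fin 2 → Fin 2 → F => f₁ (Matrix.of x)) δ M C)
    (h₂ : IsUniformlyLocallyConstant (fun x : Fin 2 → Fin 2 → F => f₂ (Matrix.of x)) δ M C)
    {b : F} {α : V F} {t : Fˣ} {v : V F} (hne : kernel ψ f₁ f₂ b α t v ≠ 0) :
    ‖v‖ ≤ M ∧ ‖(t : F)‖ ≤ M := by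
  rw [kernel_eq] at hne
  exact norm_le_of_cellEntries (h₁.support _ (left_ne_zero_of_mul (left_ne_zero_of_mul hne)))
    (h₂.support _ (right_ne_zero_of_mul (left_ne_zero_of_mul hne)))

end Kernel

/-! ### The quadratic form and the pairing in coordinates -/

section Coordinates

variable {F : Type*} [NormedField F] [IsUltrametricDist F]

lemma norm_add_le_of_le {x y : F} {B : ℝ} (hx : ‖x‖ ≤ B) (hy : ‖y‖ ≤ B) : ‖x + y‖ ≤ B :=
  (IsUltrametricDist.norm_add_le_max _ _).trans (max_le hx hy)

lemma norm_sub_le_of_le {x y : F} {B : ℝ} (hx : ‖x‖ ≤ B) (hy : ‖y‖ ≤ B) : ‖x - y‖ ≤ B := by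
  rw [sub_eq_add_neg]; exact norm_add_le_of_le hx (by rwa [norm_neg])

lemma norm_coord_le (v : V F) : (∀ i j, ‖v.1 i j‖ ≤ ‖v‖) ∧ ‖v.2.1‖ ≤ ‖v‖ ∧ ‖v.2.2‖ ≤ ‖v‖ :=
  ⟨fun i j => (norm_le_pi_norm _ j).trans ((norm_le_pi_norm _ i).trans (norm_fst_le v)),
    (norm_fst_le v.2).trans (norm_snd_le v), (norm_snd_le v.2).trans (norm_snd_le v)⟩

/-- The quadratic form `b det T - t₁ t₂`. -/
def quadForm (b : F) (v : V F) : F :=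
  b * (v.1 0 0 * v.1 1 1 - v.1 0 1 * v.1 1 0) - v.2.1 * v.2.2

lemma norm_quadForm_add_sub_le (b : F) {v k : V F} {B : ℝ} (hv : ‖v‖ ≤ B) (hk : ‖k‖ ≤ B) :
    ‖quadForm b (v + k) - quadForm b v‖ ≤ max 1 ‖b‖ * (B * ‖k‖) := by
  have hB : 0 ≤ B := (norm_nonneg _).trans hv
  obtain ⟨hv1, hv2, hv3⟩ := norm_coord_le v
  obtain ⟨hk1, hk2, hk3⟩ := norm_coord_le k
  have hBk : 0 ≤ B * ‖k‖ := by positivity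
  have aux : ∀ {x y X Y : F}, ‖x‖ ≤ ‖v‖ → ‖X‖ ≤ ‖k‖ → ‖y‖ ≤ ‖v‖ → ‖Y‖ ≤ ‖k‖ →
      ‖(x + X) * (y + Y) - x * y‖ ≤ B * ‖k‖ := by
    intro x y X Y hx hX hy hY
    have : (x + X) * (y + Y) - x * y = x * Y + X * (y + Y) := by ring
    rw [this]
    refine norm_add_le_of_le ?_ ?_
    · rw [norm_mul]; exact mul_le_mul (hx.trans hv) hY (norm_nonneg _) hB
    · rw [norm_mul, mul_comm]
      exact mul_le_mul (norm_add_le_of_le (hy.trans hv) (hY.trans hk)) hX (norm_nonneg _) hB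
  have h1 := aux (hv1 0 0) (hk1 0 0) (hv1 1 1) (hk1 1 1)
  have h2 := aux (hv1 0 1) (hk1 0 1) (hv1 1 0) (hk1 1 0)
  have h3 := aux hv2 hk2 hv3 hk3
  have : quadForm b (v + k) - quadForm b v =
      b * (((v.1 0 0 + k.1 0 0) * (v.1 1 1 + k.1 1 1) - v.1 0 0 * v.1 1 1) -
        ((v.1 0 1 + k.1 0 1) * (v.1 1 0 + k.1 1 0) - v.1 0 1 * v.1 1 0)) -
      ((v.2.1 + k.2.1) * (v.2.2 + k.2.2) - v.2.1 * v.2.2) := by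
    simp [quadForm]; ring
  rw [this]
  refine norm_sub_le_of_le ?_ ?_
  · rw [norm_mul]
    exact mul_le_mul (le_max_right _ _) (norm_sub_le_of_le h1 h2) (norm_nonneg _) (by positivity)
  · exact h3.trans (le_mul_of_one_le_left hBk (le_max_left _ _))

lemma cellEntries_add (b t : F) (v k : V F) :
    cellEntries b t (v + k) = cellEntries b t v +
      ![![-k.2.1, (quadForm b (v + k) - quadForm b v) / t], ![0, k.2.2]] := by
  ext i j
  fin_cases i <;> fin_cases j <;> simp [cellEntries, quadForm]
  · ring
  · ring

lemma norm_matrix_le {x y z w : F} {B : ℝ} (hx : ‖x‖ ≤ B) (hy : ‖y‖ ≤ B) (hz : ‖z‖ ≤ B)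
    (hw : ‖w‖ ≤ B) : ‖(![![x, y], ![z, w]] : Fin 2 → Fin 2 → F)‖ ≤ B := by
  have hB : 0 ≤ B := (norm_nonneg _).trans hx
  refine (pi_norm_le_iff_of_nonneg hB).2 fun i => (pi_norm_le_iff_of_nonneg hB).2 fun j => ?_
  fin_cases i <;> fin_cases j <;> simpa

lemma pairing_add (α v k : V F) : pairing α (v + k) = pairing α v + pairing α k := by
  simp only [pairing_eq, Prod.fst_add, Prod.snd_add, Pi.add_apply]; ring

lemma norm_eq_max (α : V F) : ‖α‖ =
    max (max (max ‖α.1 0 0‖ ‖α.1 0 1‖) (max ‖α.1 1 0‖ ‖α.1 1 1‖)) (max ‖α.2.1‖ ‖α.2.2‖) := by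
  obtain ⟨h1, h2, h3⟩ := norm_coord_le α
  refine le_antisymm (max_le ?_ le_sup_right) (by simp [h1, h2, h3])
  refine le_sup_of_le_left ?_
  have h0 : 0 ≤ max (max ‖α.1 0 0‖ ‖α.1 0 1‖) (max ‖α.1 1 0‖ ‖α.1 1 1‖) :=
    le_sup_of_le_left (le_sup_of_le_left (norm_nonneg _))
  refine (pi_norm_le_iff_of_nonneg h0).2 fun i => (pi_norm_le_iff_of_nonneg h0).2 fun j => ?_
  fin_cases i <;> fin_cases j <;> simp

/-- The sup norm is self-dual for the pairing: `c` is a coordinate of `α` of largest norm, and `k`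
has `x` in the position dual to it and `0` elsewhere. The trace pairs `b_ij` with `T_ji`, hence the
transposition in the witness. -/
lemma exists_pairing_eq_mul (α : V F) : ∃ c : F, ‖c‖ = ‖α‖ ∧
    ∀ x : F, ∃ k : V F, ‖k‖ ≤ ‖x‖ ∧ pairing α k = c * x := by
  have key : ∀ x y z w s t X : F, ‖x‖ ≤ ‖X‖ → ‖y‖ ≤ ‖X‖ → ‖z‖ ≤ ‖X‖ → ‖w‖ ≤ ‖X‖ → ‖s‖ ≤ ‖X‖ →
      ‖t‖ ≤ ‖X‖ → ∃ k : V F, ‖k‖ ≤ ‖X‖ ∧ pairing α k = α.1 0 0 * x + α.1 0 1 * y +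
        (α.1 1 0 * z + α.1 1 1 * w) + α.2.1 * s + α.2.2 * t := by
    intro x y z w s t X hx hy hz hw hs ht
    exact ⟨(![![x, z], ![y, w]], s, t), max_le (norm_matrix_le hx hz hy hw) (max_le hs ht),
      by simp [pairing_eq]⟩
  rw [norm_eq_max]
  rcases max_choice (max (max ‖α.1 0 0‖ ‖α.1 0 1‖) (max ‖α.1 1 0‖ ‖α.1 1 1‖))
    (max ‖α.2.1‖ ‖α.2.2‖) with h | h <;> rw [h]
  · rcases max_choice (max ‖α.1 0 0‖ ‖α.1 0 1‖) (max ‖α.1 1 0‖ ‖α.1 1 1‖) with h | h <;> rw [h]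
    · rcases max_choice ‖α.1 0 0‖ ‖α.1 0 1‖ with h | h <;> rw [h]
      · exact ⟨_, rfl, fun x => by simpa using key x 0 0 0 0 0 x⟩
      · exact ⟨_, rfl, fun x => by simpa using key 0 x 0 0 0 0 x⟩
    · rcases max_choice ‖α.1 1 0‖ ‖α.1 1 1‖ with h | h <;> rw [h]
      · exact ⟨_, rfl, fun x => by simpa using key 0 0 x 0 0 0 x⟩
      · exact ⟨_, rfl, fun x => by simpa using key 0 0 0 x 0 0 x⟩
  · rcases max_choice ‖α.2.1‖ ‖α.2.2‖ with h | h <;> rw [h]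
    · exact ⟨_, rfl, fun x => by simpa using key 0 0 0 0 x 0 x⟩
    · exact ⟨_, rfl, fun x => by simpa using key 0 0 0 0 0 x x⟩

end Coordinates

/-! ### The inner integral: boundedness, vanishing for large `α`, unit invariance -/

section Inner

variable {F : Type*} [NormedField F] [IsUltrametricDist F] [ProperSpace F] [MeasurableSpace F]
  [BorelSpace F] {Q : ℕ} {ϖ : F}

instance volV_isAddHaarMeasure (μ : Measure F) [μ.IsAddHaarMeasure] :
    (volV μ).IsAddHaarMeasure := by
  have h1 : (Measure.pi fun _ : Fin 2 => μ).IsAddHaarMeasure := inferInstance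
  have h2 : (Measure.pi fun _ : Fin 2 => Measure.pi fun _ : Fin 2 => μ).IsAddHaarMeasure :=
    Measure.pi.isAddHaarMeasure (fun _ : Fin 2 => Measure.pi fun _ : Fin 2 => μ)
  exact Measure.prod.instIsAddHaarMeasure
    (Measure.pi fun _ : Fin 2 => Measure.pi fun _ : Fin 2 => μ) (μ.prod μ)

instance prod_isUltrametricDist {X Y : Type*} [PseudoMetricSpace X] [PseudoMetricSpace Y]
    [IsUltrametricDist X] [IsUltrametricDist Y] : IsUltrametricDist (X × Y) where
  dist_triangle_max x y z := by
    simp only [Prod.dist_eq]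
    exact max_le
      ((dist_triangle_max x.1 y.1 z.1).trans (max_le_max (le_max_left _ _) (le_max_left _ _)))
      ((dist_triangle_max x.2 y.2 z.2).trans (max_le_max (le_max_right _ _) (le_max_right _ _)))

/-- The inner integral over `𝒱(F)`. -/
def innerIntegral (μ : Measure F) (ψ : AddChar F Circle) (f₁ f₂ : Matrix (Fin 2) (Fin 2) F → ℂ)
    (b : F) (α : V F) (t : Fˣ) : ℂ :=
  ∫ v, kernel ψ f₁ f₂ b α t v ∂(volV μ)

variable {μ : Measure F} [μ.IsAddHaarMeasure] {ψ : AddChar F Circle}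
  {f₁ f₂ : Matrix (Fin 2) (Fin 2) F → ℂ} {δ M C : ℝ}

lemma integrable_kernel (hψ : Continuous ψ)
    (h₁ : IsUniformlyLocallyConstant (fun x : Fin 2 → Fin 2 → F => f₁ (Matrix.of x)) δ M C)
    (h₂ : IsUniformlyLocallyConstant (fun x : Fin 2 → Fin 2 → F => f₂ (Matrix.of x)) δ M C)
    (b : F) (α : V F) (t : Fˣ) : Integrable (kernel ψ f₁ f₂ b α t) (volV μ) := by
  have hc : Continuous (kernel ψ f₁ f₂ b α t) :=
    (continuous_kernel hψ h₁.continuous h₂.continuous b α).comp (Continuous.prodMk_right t)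
  refine hc.integrable_of_hasCompactSupport ?_
  refine HasCompactSupport.intro (isCompact_closedBall (0 : V F) M) fun v hv => ?_
  by_contra hne
  exact hv (by simpa using (norm_le_of_kernel_ne_zero h₁ h₂ hne).1)

lemma innerIntegral_eq_zero_of_lt_norm
    (h₁ : IsUniformlyLocallyConstant (fun x : Fin 2 → Fin 2 → F => f₁ (Matrix.of x)) δ M C)
    (h₂ : IsUniformlyLocallyConstant (fun x : Fin 2 → Fin 2 → F => f₂ (Matrix.of x)) δ M C)
    {b : F} {α : V F} {t : Fˣ} (ht : M < ‖(t : F)‖) : innerIntegral μ ψ f₁ f₂ b α t = 0 := by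
  have : ∀ v, kernel ψ f₁ f₂ b α t v = 0 := fun v => by
    by_contra hne
    exact (norm_le_of_kernel_ne_zero h₁ h₂ hne).2.not_gt ht
  simp [innerIntegral, this]

lemma norm_innerIntegral_le
    (h₁ : IsUniformlyLocallyConstant (fun x : Fin 2 → Fin 2 → F => f₁ (Matrix.of x)) δ M C)
    (h₂ : IsUniformlyLocallyConstant (fun x : Fin 2 → Fin 2 → F => f₂ (Matrix.of x)) δ M C)
    (b : F) (α : V F) (t : Fˣ) :
    ‖innerIntegral μ ψ f₁ f₂ b α t‖ ≤ C ^ 2 * (volV μ).real (Metric.closedBall 0 M) := by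
  have : innerIntegral μ ψ f₁ f₂ b α t =
      ∫ v in Metric.closedBall 0 M, kernel ψ f₁ f₂ b α t v ∂(volV μ) := by
    refine (setIntegral_eq_integral_of_forall_compl_eq_zero fun v hv => ?_).symm
    by_contra hne
    exact hv (by simpa using (norm_le_of_kernel_ne_zero h₁ h₂ hne).1)
  rw [this]
  exact norm_setIntegral_le_of_norm_le_const (isCompact_closedBall _ _).measure_lt_top
    fun v _ => norm_kernel_le h₁ h₂ b α t v

/-- The kernel is quasi-invariant under small translations. -/
lemma kernel_add
    (h₁ : IsUniformlyLocallyConstant (fun x : Fin 2 → Fin 2 → F => f₁ (Matrix.of x)) δ M C)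
    (h₂ : IsUniformlyLocallyConstant (fun x : Fin 2 → Fin 2 → F => f₂ (Matrix.of x)) δ M C)
    (hδM : δ ≤ M) {b : F} {α : V F} {t : Fˣ} {k : V F} (hk : ‖k‖ ≤ δ)
    (hk' : max 1 ‖b‖ * (M * ‖k‖) ≤ δ * ‖(t : F)‖) (v : V F) :
    kernel ψ f₁ f₂ b α t (v + k) = (ψ (pairing α k / t) : ℂ) * kernel ψ f₁ f₂ b α t v := by
  by_cases hv : ‖v‖ ≤ M
  · have hkc := norm_coord_le k
    have ht : 0 < ‖(t : F)‖ := norm_pos_iff.2 t.ne_zero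
    have e1 : f₁ (Matrix.of (v + k).1) = f₁ (Matrix.of v.1) :=
      h₁.invariant v.1 k.1 ((norm_fst_le k).trans hk)
    have e2 : f₂ (Matrix.of (cellEntries b t (v + k))) = f₂ (Matrix.of (cellEntries b t v)) := by
      rw [cellEntries_add]
      refine h₂.invariant _ _ (norm_matrix_le ?_ ?_ ?_ ?_)
      · rw [norm_neg]; exact hkc.2.1.trans hk
      -- This entry is divided by `t`, which is why the translation must be of size `O(|t|)`.
      · rw [norm_div, div_le_iff₀ ht]
        exact (norm_quadForm_add_sub_le b hv (hk.trans hδM)).trans hk'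
      · rw [norm_zero]; exact (norm_nonneg _).trans hk
      · exact hkc.2.2.trans hk
    rw [kernel_eq, kernel_eq, e1, e2, pairing_add, add_div, AddChar.map_add_eq_mul, Circle.coe_mul]
    ring
  · have z1 : kernel ψ f₁ f₂ b α t v = 0 := by
      by_contra hne; exact hv (norm_le_of_kernel_ne_zero h₁ h₂ hne).1
    have z2 : kernel ψ f₁ f₂ b α t (v + k) = 0 := by
      by_contra hne
      have h3 := (norm_le_of_kernel_ne_zero h₁ h₂ hne).1
      apply hv
      rw [← add_neg_cancel_right v k]
      refine (IsUltrametricDist.norm_add_le_max _ _).trans (max_le h3 ?_)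
      rw [norm_neg]; exact hk.trans hδM
    rw [z1, z2, mul_zero]

/-- The inner integral vanishes for large `α`. -/
lemma exists_innerIntegral_eq_zero (h : IsNormalizedUniformizer Q ϖ) {a : F}
    (ha : IsConductor ψ a)
    (h₁ : IsUniformlyLocallyConstant (fun x : Fin 2 → Fin 2 → F => f₁ (Matrix.of x)) δ M C)
    (h₂ : IsUniformlyLocallyConstant (fun x : Fin 2 → Fin 2 → F => f₂ (Matrix.of x)) δ M C)
    (hδ : 0 < δ) (hδM : δ ≤ M) (r : ℝ) :
    ∃ R : ℝ, ∀ (b : F), ‖b‖ = r → ∀ (α : V F) (t : Fˣ), R < ‖α‖ →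
      innerIntegral μ ψ f₁ f₂ b α t = 0 := by
  have hM : 0 < M := hδ.trans_le hδM
  obtain ⟨e, he0, he⟩ := h.exists_norm_le (ε := δ / (max 1 r * M)) (by positivity)
  rw [le_div_iff₀ (by positivity)] at he
  refine ⟨‖a‖ / ‖e‖, fun b hb α t hα => ?_⟩
  rcases lt_or_ge M ‖(t : F)‖ with ht | ht
  · exact innerIntegral_eq_zero_of_lt_norm h₁ h₂ ht
  obtain ⟨c, hc, hck⟩ := exists_pairing_eq_mul α
  have he' : 0 < ‖e‖ := norm_pos_iff.2 he0
  have hlt : ¬ ‖c * e‖ ≤ ‖a‖ := by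
    rw [norm_mul, hc, not_le]; rwa [div_lt_iff₀ he'] at hα
  rw [← ha] at hlt
  push Not at hlt
  obtain ⟨y, hy, hψy⟩ := hlt
  -- With this `k` the phase `⟨α, k⟩ / t = y c e` no longer involves `t`, so the threshold for `|α|`
  -- is uniform in `t`.
  obtain ⟨k, hk, hαk⟩ := hck (t * e * y)
  have hk1 : ‖k‖ ≤ ‖(t : F)‖ * ‖e‖ := by
    refine hk.trans ?_
    rw [norm_mul, norm_mul]
    exact mul_le_of_le_one_right (by positivity) hy
  have hmax : (1 : ℝ) ≤ max 1 r := le_max_left _ _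
  refine integral_eq_zero_of_add_right (volV μ) (h := k) (ζ := ψ (pairing α k / t))
    (kernel_add h₁ h₂ hδM ?_ ?_) ?_
  · refine hk1.trans (le_trans ?_ he)
    rw [mul_comm]
    gcongr
    nlinarith
  · rw [hb]
    calc max 1 r * (M * ‖k‖) ≤ max 1 r * (M * (‖(t : F)‖ * ‖e‖)) := by gcongr
      _ = ‖e‖ * (max 1 r * M) * ‖(t : F)‖ := by ring
      _ ≤ δ * ‖(t : F)‖ := by gcongr
  · have : pairing α k / t = y * (c * e) := by
      rw [hαk]; field_simp
    rw [this]
    exact fun h1 => hψy (Circle.ext (by simpa using h1))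

/-- The inner integral is invariant under units close to `1`. -/
lemma innerIntegral_unit_mul
    (h₁ : IsUniformlyLocallyConstant (fun x : Fin 2 → Fin 2 → F => f₁ (Matrix.of x)) δ M C)
    (h₂ : IsUniformlyLocallyConstant (fun x : Fin 2 → Fin 2 → F => f₂ (Matrix.of x)) δ M C)
    (b : F) (α : V F) (t : Fˣ) {u : Fˣ} (hu : ‖(u : F)‖ = 1) (hu1 : ‖(u : F) - 1‖ * M ≤ δ) :
    innerIntegral μ ψ f₁ f₂ b α (u * t) = innerIntegral μ ψ f₁ f₂ b α t := by
  have hmp := measurePreserving_unit_smul (E := V F) (volV μ) hu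
  rw [innerIntegral, innerIntegral, ← hmp.integral_comp
    (Homeomorph.smulOfNeZero (u : F) u.ne_zero).measurableEmbedding]
  congr 1
  ext v
  have e1 : f₁ (Matrix.of ((u : F) • v).1) = f₁ (Matrix.of v.1) := h₁.unit_smul hu hu1 v.1
  -- The upper right entry is a quadratic form over `t`, so it too is homogeneous of degree one in
  -- `(t, v)`.
  have e2 : cellEntries b ((u * t : Fˣ) : F) ((u : F) • v) = (u : F) • cellEntries b t v := by
    ext i j
    have hu0 := u.ne_zero
    have ht0 := t.ne_zero
    fin_cases i <;> fin_cases j <;> simp [cellEntries]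
    field_simp
  have e3 : pairing α ((u : F) • v) / ((u * t : Fˣ) : F) = pairing α v / t := by
    have hu0 := u.ne_zero
    have ht0 := t.ne_zero
    simp only [pairing_eq, Prod.smul_fst, Prod.smul_snd, Pi.smul_apply, smul_eq_mul, Units.val_mul]
    field_simp
  have e4 : f₂ (Matrix.of ((u : F) • cellEntries b t v)) = f₂ (Matrix.of (cellEntries b t v)) :=
    h₂.unit_smul hu hu1 (cellEntries b t v)
  rw [kernel_eq, kernel_eq, e1, e2, e3, e4]

end Inner

/-! ### Splitting into hyperbolic planes and Fourier expansion -/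

section Decay

variable {F : Type*} [NormedField F] [IsUltrametricDist F] [ProperSpace F] [MeasurableSpace F]
  [BorelSpace F] {Q : ℕ} {ϖ : F}

/-- The coordinates of `𝒱(F)` grouped into the three hyperbolic planes of the form
`b det T - t₁ t₂`. -/
def planes (F : Type*) [NormedField F] : V F ≃ₜ+ (F × F) × (F × F) × (F × F) where
  toFun v := ((v.1 0 0, v.1 1 1), (v.1 0 1, v.1 1 0), v.2)
  invFun p := (![![p.1.1, p.2.1.1], ![p.2.1.2, p.1.2]], p.2.2)
  left_inv v := by
    refine Prod.ext ?_ rfl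
    ext i j
    fin_cases i <;> fin_cases j <;> rfl
  right_inv _ := rfl
  map_add' _ _ := rfl
  continuous_toFun := by fun_prop
  continuous_invFun := by
    refine Continuous.prodMk ?_ (by fun_prop)
    refine continuous_pi fun i => continuous_pi fun j => ?_
    fin_cases i <;> fin_cases j <;> simp <;> fun_prop

lemma planes_apply (v : V F) : planes F v = ((v.1 0 0, v.1 1 1), (v.1 0 1, v.1 1 0), v.2) := rfl

lemma measurePreserving_planes (μ : Measure F) [μ.IsAddHaarMeasure] :
    MeasurePreserving (planes F) (volV μ) ((μ.prod μ).prod ((μ.prod μ).prod (μ.prod μ))) := by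
  have : (μ.prod μ).IsAddHaarMeasure := inferInstance
  have : ((μ.prod μ).prod (μ.prod μ)).IsAddHaarMeasure :=
    Measure.prod.instIsAddHaarMeasure (μ.prod μ) (μ.prod μ)
  have : ((μ.prod μ).prod ((μ.prod μ).prod (μ.prod μ))).IsAddHaarMeasure :=
    Measure.prod.instIsAddHaarMeasure (μ.prod μ) ((μ.prod μ).prod (μ.prod μ))
  refine measurePreserving_of_measure_preimage_closedBall _ _ _ ?_
  -- Both norms are the maximum over the same six coordinates, so unit balls correspond; both have
  -- measure the sixth power of that of the unit ball of `F`.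
  have h1 : planes F ⁻¹' Metric.closedBall 0 1 = Metric.closedBall 0 1 := by
    ext v
    rw [Set.mem_preimage, mem_closedBall_zero_iff, mem_closedBall_zero_iff, norm_eq_max v]
    simp only [planes_apply, Prod.norm_def, sup_le_iff]
    tauto
  rw [h1]
  have h2 : (0 : V F) = (fun _ _ => 0, 0, 0) := rfl
  have h3 : (0 : (F × F) × (F × F) × (F × F)) = ((0, 0), (0, 0), (0, 0)) := rfl
  have h4 : (fun _ _ => 0 : Fin 2 → Fin 2 → F) = fun _ => (fun _ => 0 : Fin 2 → F) := rfl
  rw [h2, h3]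
  simp only [← closedBall_prod_same, volV, Measure.prod_prod]
  rw [h4, closedBall_pi _ zero_le_one, Measure.pi_pi]
  simp only [closedBall_pi _ (zero_le_one (α := ℝ)), Measure.pi_pi, Fin.prod_univ_two]
  ring

variable {μ : Measure F} [μ.IsAddHaarMeasure] {ψ : AddChar F Circle}

/-- The product of balls on which the entries of `T` and the diagonal entries of the cell matrix
are close to given ones. -/
def box (c e : Fin 2 → Fin 2 → F) (r : ℝ) : Set (V F) :=
  planes F ⁻¹' ((Metric.closedBall (c 0 0) r ×ˢ Metric.closedBall (c 1 1) r) ×ˢ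
    (Metric.closedBall (c 0 1) r ×ˢ Metric.closedBall (c 1 0) r) ×ˢ
    (Metric.closedBall (-e 0 0) r ×ˢ Metric.closedBall (e 1 1) r))

lemma isCompact_box (c e : Fin 2 → Fin 2 → F) (r : ℝ) : IsCompact (box c e r) := by
  rw [box]
  refine (planes F).toHomeomorph.isCompact_preimage.2 ?_
  exact ((isCompact_closedBall _ _).prod (isCompact_closedBall _ _)).prod
    (((isCompact_closedBall _ _).prod (isCompact_closedBall _ _)).prod
      ((isCompact_closedBall _ _).prod (isCompact_closedBall _ _)))

/-- The quadratic form is an orthogonal sum of planes spanned by `(T₀₀, T₁₁)`, `(T₀₁, T₁₀)` and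
`(t₁, t₂)`, with coefficients `b`, `-b`, `-1`, and the linear term splits accordingly. So the
character is a product over a product of domains. -/
lemma setIntegral_box (c e : Fin 2 → Fin 2 → F) (r : ℝ) (κ b t : F) (α : V F) :
    ∫ v in box c e r, (ψ (κ * (quadForm b v / t) + pairing α v / t) : ℂ) ∂(volV μ) =
      hyperbolicIntegral μ ψ (c 0 0) (c 1 1) r (κ * b / t) (α.1 0 0 / t) (α.1 1 1 / t) *
      (hyperbolicIntegral μ ψ (c 0 1) (c 1 0) r (-(κ * b / t)) (α.1 1 0 / t) (α.1 0 1 / t) *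
        hyperbolicIntegral μ ψ (-e 0 0) (e 1 1) r (-(κ / t)) (α.2.1 / t) (α.2.2 / t)) := by
  simp only [hyperbolicIntegral]
  rw [← setIntegral_prod_mul, ← setIntegral_prod_mul,
    ← (measurePreserving_planes μ).setIntegral_preimage_emb
      (planes F).toHomeomorph.measurableEmbedding]
  rw [box]
  congr 1
  ext v
  rw [← Circle.coe_mul, ← AddChar.map_add_eq_mul, ← Circle.coe_mul, ← AddChar.map_add_eq_mul]
  congr 2
  simp only [planes_apply, quadForm, pairing_eq]
  ring

/-- The indicator function of a ball of matrices. -/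
def ballIndicator (c : Fin 2 → Fin 2 → F) (r : ℝ) (x : Matrix (Fin 2) (Fin 2) F) : ℂ :=
  if ‖(fun i j => x i j) - c‖ ≤ r then 1 else 0

lemma isUniformlyLocallyConstant_ballIndicator (c : Fin 2 → Fin 2 → F) {r : ℝ} (hr : 0 < r) :
    IsUniformlyLocallyConstant (fun x : Fin 2 → Fin 2 → F => ballIndicator c r (Matrix.of x))
      r (max ‖c‖ r) 1 := by
  have hinv : ∀ x h : Fin 2 → Fin 2 → F, ‖h‖ ≤ r →
      ballIndicator c r (Matrix.of (x + h)) = ballIndicator c r (Matrix.of x) := by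
    intro x h hh
    have := add_mem_closedBall_iff (x₀ := c) (x := x) hh
    rw [Metric.mem_closedBall, Metric.mem_closedBall, dist_eq_norm, dist_eq_norm] at this
    exact if_congr this rfl rfl
  refine ⟨?_, hinv, ?_, ?_⟩
  · refine continuous_iff_continuousAt.2 fun x => ?_
    refine (continuousAt_const (y := ballIndicator c r (Matrix.of x))).congr ?_
    filter_upwards [Metric.closedBall_mem_nhds x hr] with y hy
    rw [mem_closedBall_iff_norm] at hy
    have := hinv x (y - x) hy
    rw [add_sub_cancel] at this
    exact this.symm
  · intro x hx
    have hxc : ‖x - c‖ ≤ r := by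
      by_contra hlt; exact hx (if_neg hlt)
    rw [← sub_add_cancel x c, max_comm]
    exact (IsUltrametricDist.norm_add_le_max _ _).trans (max_le_max hxc le_rfl)
  · intro x
    simp only [ballIndicator]
    split_ifs <;> simp

lemma matrix_norm_sub_le_iff (x c : Fin 2 → Fin 2 → F) {r : ℝ} (hr : 0 ≤ r) : ‖x - c‖ ≤ r ↔
    (‖x 0 0 - c 0 0‖ ≤ r ∧ ‖x 0 1 - c 0 1‖ ≤ r) ∧ ‖x 1 0 - c 1 0‖ ≤ r ∧ ‖x 1 1 - c 1 1‖ ≤ r := by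
  simp [pi_norm_le_iff_of_nonneg hr, Fin.forall_fin_two]

/-- The conditions on single coordinates are absorbed into the box. The condition on the upper right
entry, the only one involving `quadForm`, is kept apart for the Fourier expansion. -/
lemma kernel_ballIndicator {c e : Fin 2 → Fin 2 → F} {r : ℝ} (hr : 0 ≤ r) {b : F} {α : V F}
    {t : Fˣ} (ht : ‖(t : F) - e 1 0‖ ≤ r) (v : V F) :
    kernel ψ (ballIndicator c r) (ballIndicator e r) b α t v =
      (box c e r).indicator (fun v => (if ‖quadForm b v / t - e 0 1‖ ≤ r then (1 : ℂ) else 0) *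
        (ψ (pairing α v / t) : ℂ)) v := by
  classical
  rw [kernel_eq, Set.indicator_apply]
  have h1 : ballIndicator c r (Matrix.of v.1) = if ‖v.1 - c‖ ≤ r then 1 else 0 := rfl
  have h2 : ballIndicator e r (Matrix.of (cellEntries b t v)) =
    if ‖cellEntries b t v - e‖ ≤ r then 1 else 0 := rfl
  have h3 : v ∈ box c e r ↔ ‖v.1 - c‖ ≤ r ∧ ‖-v.2.1 - e 0 0‖ ≤ r ∧ ‖v.2.2 - e 1 1‖ ≤ r := by
    have : ‖-v.2.1 - e 0 0‖ = ‖v.2.1 - -e 0 0‖ := by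
      rw [← norm_neg]; congr 1; ring
    rw [matrix_norm_sub_le_iff _ _ hr, this]
    simp only [box, Set.mem_preimage, Set.mem_prod, planes_apply, mem_closedBall_iff_norm]
    tauto
  have h4 : ‖cellEntries b t v - e‖ ≤ r ↔
      ‖-v.2.1 - e 0 0‖ ≤ r ∧ ‖quadForm b v / t - e 0 1‖ ≤ r ∧ ‖v.2.2 - e 1 1‖ ≤ r := by
    rw [matrix_norm_sub_le_iff _ _ hr]
    simp only [cellEntries, quadForm, Matrix.cons_val_zero, Matrix.cons_val_one]
    tauto
  rw [h1, h2]
  by_cases c1 : ‖v.1 - c‖ ≤ r <;> by_cases c2 : ‖-v.2.1 - e 0 0‖ ≤ r <;>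
    by_cases c3 : ‖quadForm b v / t - e 0 1‖ ≤ r <;> by_cases c4 : ‖v.2.2 - e 1 1‖ ≤ r <;>
    simp [h3, h4, c1, c2, c3, c4]

lemma continuous_quadForm (b : F) : Continuous (quadForm b) := by
  unfold quadForm; fun_prop

lemma continuous_pairing (α : V F) : Continuous (pairing α) := by
  have : pairing α = fun v => pairing α v := rfl
  rw [this]; simp only [pairing_eq]; fun_prop

/-- Fourier expansion of the inner integral for indicators of balls. -/
lemma mul_innerIntegral_ballIndicator (hψ : Continuous ψ) {a : F} (ha : IsConductor ψ a)
    (ha0 : a ≠ 0) {c e : Fin 2 → Fin 2 → F} {d : F} (hd : d ≠ 0) {b : F} {α : V F} {t : Fˣ}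
    (ht : ‖(t : F) - e 1 0‖ ≤ ‖d‖) :
    (μ.real (Metric.closedBall (0 : F) 1) : ℂ) *
      innerIntegral μ ψ (ballIndicator c ‖d‖) (ballIndicator e ‖d‖) b α t =
    ∫ y in Metric.closedBall (0 : F) 1, (ψ (-(y * (a / d) * e 0 1)) : ℂ) *
      ∫ v in box c e ‖d‖, (ψ (y * (a / d) * (quadForm b v / t) + pairing α v / t) : ℂ)
        ∂(volV μ) ∂μ := by
  have hbox := isCompact_box c e ‖d‖
  rw [innerIntegral]
  simp only [kernel_ballIndicator (norm_nonneg d) ht]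
  rw [integral_indicator hbox.isClosed.measurableSet, ← integral_const_mul]
  simp only [← integral_const_mul]
  rw [← integral_integral_swap]
  · congr 1
    ext v
    -- Rescaling by `a / d` turns the radius `|d|` into the conductor radius `|a|`, where the
    -- indicator is an integral of `ψ` over the unit ball.
    have h1 : ‖quadForm b v / t - e 0 1‖ ≤ ‖d‖ ↔
        ‖a / d * (quadForm b v / t - e 0 1)‖ ≤ ‖a‖ := by
      have hd' : 0 < ‖d‖ := norm_pos_iff.2 hd
      have ha' : 0 < ‖a‖ := norm_pos_iff.2 ha0
      rw [norm_mul, norm_div, div_mul_eq_mul_div, div_le_iff₀ hd', mul_le_mul_iff_right₀ ha']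
    have h2 := integral_unitBall_char μ ha (a / d * (quadForm b v / t - e 0 1))
    have h3 : (μ.real (Metric.closedBall (0 : F) 1) : ℂ) *
        (if ‖quadForm b v / t - e 0 1‖ ≤ ‖d‖ then (1 : ℂ) else 0) =
        ∫ y in Metric.closedBall 0 1, (ψ (y * (a / d * (quadForm b v / t - e 0 1))) : ℂ) ∂μ := by
      rw [h2]; simp only [h1, mul_ite, mul_one, mul_zero]
    rw [← mul_assoc, h3, ← integral_mul_const]
    congr 1
    ext y
    simp only [← Circle.coe_mul, ← AddChar.map_add_eq_mul]
    congr 2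
    ring
  · rw [Measure.prod_restrict]
    refine ContinuousOn.integrableOn_compact (hbox.prod (isCompact_closedBall _ _)) ?_
    have h1 := continuous_quadForm b
    have h2 := continuous_pairing α
    refine Continuous.continuousOn ?_
    unfold Function.uncurry
    fun_prop

end Decay

/-! ### Cubic decay of the inner integral -/

section Decay

variable {F : Type*} [NormedField F] [IsUltrametricDist F] [ProperSpace F] [MeasurableSpace F]
  [BorelSpace F] {Q : ℕ} {ϖ : F} {μ : Measure F} [μ.IsAddHaarMeasure] {ψ : AddChar F Circle}

/-- The oscillatory integral over a box only sees `α` of size comparable to that of `η`. -/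
lemma norm_le_of_setIntegral_box_ne_zero (hψ : Continuous ψ) {a : F} (ha : IsConductor ψ a)
    {c e : Fin 2 → Fin 2 → F} {d : F} (hd : d ≠ 0) {b η : F} {α : V F} {t : Fˣ}
    (hne : ∫ v in box c e ‖d‖, (ψ (η * (quadForm b v / t) + pairing α v / t) : ℂ) ∂(volV μ) ≠ 0) :
    ‖α‖ ≤ max (‖a‖ / ‖d‖ * ‖(t : F)‖) (‖η‖ * (max 1 ‖b‖ * max (max ‖c‖ ‖e‖) ‖d‖)) := by
  rw [setIntegral_box] at hne
  have hne1 := left_ne_zero_of_mul hne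
  have hne2 := left_ne_zero_of_mul (right_ne_zero_of_mul hne)
  have hne3 := right_ne_zero_of_mul (right_ne_zero_of_mul hne)
  have ht : 0 < ‖(t : F)‖ := norm_pos_iff.2 t.ne_zero
  set Z := max (max ‖c‖ ‖e‖) ‖d‖ with hZ
  have hcZ : ∀ i j, max ‖c i j‖ ‖d‖ ≤ Z := fun i j => max_le_max
    (((norm_le_pi_norm _ j).trans (norm_le_pi_norm _ i)).trans (le_max_left _ _)) le_rfl
  have heZ : ∀ i j, max ‖e i j‖ ‖d‖ ≤ Z := fun i j => max_le_max
    (((norm_le_pi_norm _ j).trans (norm_le_pi_norm _ i)).trans (le_max_right _ _)) le_rfl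
  have heZ' : ∀ i j, max ‖-e i j‖ ‖d‖ ≤ Z := fun i j => by rw [norm_neg]; exact heZ i j
  -- Coefficients and curvature both carry a factor `1 / t`. Clearing it leaves `|t|` only in the
  -- conductor term.
  have aux : ∀ {x κ : F} {z : ℝ}, ‖κ‖ ≤ ‖η‖ * max 1 ‖b‖ → 0 ≤ z → z ≤ Z →
      ‖x / t‖ ≤ max (‖a‖ / ‖d‖) (‖κ / t‖ * z) →
      ‖x‖ ≤ max (‖a‖ / ‖d‖ * ‖(t : F)‖) (‖η‖ * (max 1 ‖b‖ * Z)) := by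
    intro x κ z hκ hz0 hz hx
    rw [norm_div, div_le_iff₀ ht, max_mul_of_nonneg _ _ ht.le] at hx
    refine hx.trans (max_le_max le_rfl ?_)
    rw [norm_div, mul_right_comm, div_mul_cancel₀ _ ht.ne', ← mul_assoc]
    gcongr
  have hκ1 : ‖η * b‖ ≤ ‖η‖ * max 1 ‖b‖ := by
    rw [norm_mul]; gcongr; exact le_max_right _ _
  have hκ2 : ‖-(η * b)‖ ≤ ‖η‖ * max 1 ‖b‖ := by rwa [norm_neg]
  have hκ3 : ‖-η‖ ≤ ‖η‖ * max 1 ‖b‖ := by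
    rw [norm_neg]; exact le_mul_of_one_le_right (norm_nonneg _) (le_max_left _ _)
  rw [← neg_div] at hne2 hne3
  have hz : ∀ x : F, 0 ≤ max ‖x‖ ‖d‖ := fun x => le_max_of_le_left (norm_nonneg _)
  rw [norm_eq_max]
  refine max_le (max_le (max_le ?_ ?_) (max_le ?_ ?_)) (max_le ?_ ?_)
  · exact aux hκ1 (hz _) (hcZ _ _)
      (norm_fst_coeff_le_of_hyperbolicIntegral_ne_zero μ hψ ha hd hne1)
  · exact aux hκ2 (hz _) (hcZ _ _)
      (norm_snd_coeff_le_of_hyperbolicIntegral_ne_zero μ hψ ha hd hne2)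
  · exact aux hκ2 (hz _) (hcZ _ _)
      (norm_fst_coeff_le_of_hyperbolicIntegral_ne_zero μ hψ ha hd hne2)
  · exact aux hκ1 (hz _) (hcZ _ _)
      (norm_snd_coeff_le_of_hyperbolicIntegral_ne_zero μ hψ ha hd hne1)
  · exact aux hκ3 (hz _) (heZ _ _)
      (norm_fst_coeff_le_of_hyperbolicIntegral_ne_zero μ hψ ha hd hne3)
  · exact aux hκ3 (hz _) (heZ' _ _)
      (norm_snd_coeff_le_of_hyperbolicIntegral_ne_zero μ hψ ha hd hne3)

/-- Each plane contributes the inverse of its curvature: `|η b / t|` twice and `|η / t|` once. -/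
lemma norm_setIntegral_box_le (h : IsNormalizedUniformizer Q ϖ) (hψ : Continuous ψ) {a : F}
    (ha : IsConductor ψ a) (ha0 : a ≠ 0) (c e : Fin 2 → Fin 2 → F) {d : F} (hd : d ≠ 0) {b η : F}
    (hb : b ≠ 0) (hη : η ≠ 0) (α : V F) (t : Fˣ) :
    ‖∫ v in box c e ‖d‖, (ψ (η * (quadForm b v / t) + pairing α v / t) : ℂ) ∂(volV μ)‖ ≤
      (‖a‖ * μ.real (Metric.closedBall (0 : F) 1) ^ 2) ^ 3 * ‖(t : F)‖ ^ 3 /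
        (‖b‖ ^ 2 * ‖η‖ ^ 3) := by
  rw [setIntegral_box, norm_mul, norm_mul]
  have ht0 := t.ne_zero
  have hκ : η * b / t ≠ 0 := by positivity
  have hκ3 : η / (t : F) ≠ 0 := by positivity
  have b1 := norm_hyperbolicIntegral_le h μ hψ ha0 ha (c 0 0) (c 1 1) hd hκ
    (α.1 0 0 / t) (α.1 1 1 / t)
  have b2 := norm_hyperbolicIntegral_le h μ hψ ha0 ha (c 0 1) (c 1 0) hd (neg_ne_zero.2 hκ)
    (α.1 1 0 / t) (α.1 0 1 / t)
  have b3 := norm_hyperbolicIntegral_le h μ hψ ha0 ha (-e 0 0) (e 1 1) hd (neg_ne_zero.2 hκ3)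
    (α.2.1 / t) (α.2.2 / t)
  refine (mul_le_mul b1 (mul_le_mul b2 b3 (norm_nonneg _) (by positivity)) (by positivity)
    (by positivity)).trans (le_of_eq ?_)
  simp only [norm_neg, norm_div, norm_mul]
  have := norm_ne_zero_iff.2 ht0
  have := norm_ne_zero_iff.2 hb
  have := norm_ne_zero_iff.2 hη
  field_simp

/-- If `|α|` is at most a multiple of `|t|`, the trivial bound is enough. Otherwise only frequencies
with `|η|` at least a multiple of `|α|` contribute, and for these `|t|³ / |η|³` is at most a
multiple of `|t|³ / |α|³`. The two cases supply the two summands of the constant. -/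
lemma exists_innerIntegral_ballIndicator_le (h : IsNormalizedUniformizer Q ϖ) (hψ : Continuous ψ)
    {a : F} (ha : IsConductor ψ a) (ha0 : a ≠ 0) {d : F} (hd : d ≠ 0) {r : ℝ} (hr : 0 < r)
    (c e : Fin 2 → Fin 2 → F) :
    ∃ C : ℝ, ∀ b : F, ‖b‖ = r → ∀ (α : V F) (t : Fˣ),
      ‖innerIntegral μ ψ (ballIndicator c ‖d‖) (ballIndicator e ‖d‖) b α t‖ * ‖α‖ ^ 3 ≤
        C * ‖(t : F)‖ ^ 3 := by
  have hd' : 0 < ‖d‖ := norm_pos_iff.2 hd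
  set Z := max (max ‖c‖ ‖e‖) ‖d‖ with hZ
  set m := μ.real (Metric.closedBall (0 : F) 1) with hm
  have hm0 : 0 < m := measureReal_closedBall_pos μ
  set C₀ := (volV μ).real (Metric.closedBall 0 Z) with hC₀
  have hZ0 : 0 ≤ Z := hd'.le.trans (le_max_right _ _)
  refine ⟨C₀ * (‖a‖ / ‖d‖) ^ 3 + (‖a‖ * m ^ 2) ^ 3 / r ^ 2 * (max 1 r * Z) ^ 3,
    fun b hb α t => ?_⟩
  have hC₀0 : 0 ≤ C₀ := measureReal_nonneg
  have hb0 : b ≠ 0 := by rw [← norm_pos_iff, hb]; exact hr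
  have htpos : 0 < ‖(t : F)‖ := norm_pos_iff.2 t.ne_zero
  have hci := (isUniformlyLocallyConstant_ballIndicator c hd').mono le_rfl
    (max_le_max (le_max_left ‖c‖ ‖e‖) le_rfl) le_rfl
  have hei := (isUniformlyLocallyConstant_ballIndicator e hd').mono le_rfl
    (max_le_max (le_max_right ‖c‖ ‖e‖) le_rfl) le_rfl
  have hP1 : 0 ≤ C₀ * (‖a‖ / ‖d‖) ^ 3 * ‖(t : F)‖ ^ 3 := by positivity
  have hP2 : 0 ≤ (‖a‖ * m ^ 2) ^ 3 / r ^ 2 * (max 1 r * Z) ^ 3 * ‖(t : F)‖ ^ 3 := by positivity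
  rw [add_mul]
  rcases le_or_gt ‖α‖ (‖a‖ / ‖d‖ * ‖(t : F)‖) with hα | hα
  · have h1 := norm_innerIntegral_le (μ := μ) (ψ := ψ) hci hei b α t
    rw [one_pow, one_mul] at h1
    have h2 := mul_le_mul h1 (pow_le_pow_left₀ (norm_nonneg α) hα 3) (by positivity) hC₀0
    rw [mul_pow, ← mul_assoc] at h2
    linarith
  by_cases ht : ‖(t : F) - e 1 0‖ ≤ ‖d‖
  · have hbound : ∀ y ∈ Metric.closedBall (0 : F) 1, ‖(ψ (-(y * (a / d) * e 0 1)) : ℂ) *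
        ∫ v in box c e ‖d‖, (ψ (y * (a / d) * (quadForm b v / t) + pairing α v / t) : ℂ)
          ∂(volV μ)‖ ≤
        (‖a‖ * m ^ 2) ^ 3 * ‖(t : F)‖ ^ 3 / r ^ 2 * ((max 1 r * Z) ^ 3 / ‖α‖ ^ 3) := by
      intro y _
      rw [norm_mul, Circle.norm_coe, one_mul]
      set η := y * (a / d) with hη
      by_cases hne : ∫ v in box c e ‖d‖,
          (ψ (η * (quadForm b v / t) + pairing α v / t) : ℂ) ∂(volV μ) = 0
      · rw [hne, norm_zero]; positivity
      have h1 := norm_le_of_setIntegral_box_ne_zero hψ ha hd hne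
      rw [le_max_iff, or_iff_right hα.not_ge, hb] at h1
      have hα0 : 0 < ‖α‖ := lt_of_le_of_lt (by positivity) hα
      have hη0 : η ≠ 0 := by
        intro h0
        rw [h0, norm_zero, zero_mul] at h1
        exact hα0.not_ge h1
      have hη0' : 0 < ‖η‖ := norm_pos_iff.2 hη0
      refine (norm_setIntegral_box_le h hψ ha ha0 c e hd hb0 hη0 α t).trans ?_
      rw [hb, ← div_div, div_eq_mul_inv _ (‖η‖ ^ 3)]
      gcongr
      rw [inv_le_iff_one_le_mul₀ (by positivity), div_mul_eq_mul_div, le_div_iff₀ (by positivity),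
        one_mul, ← mul_pow, mul_comm]
      exact pow_le_pow_left₀ hα0.le h1 3
    have h2 := norm_setIntegral_le_of_norm_le_const
      (isCompact_closedBall (0 : F) 1).measure_lt_top hbound (μ := μ)
    rw [← mul_innerIntegral_ballIndicator hψ ha ha0 hd ht, norm_mul, Complex.norm_real,
      Real.norm_of_nonneg hm0.le, mul_comm _ (μ.real _), mul_le_mul_iff_right₀ hm0] at h2
    have hα0 : 0 < ‖α‖ := lt_of_le_of_lt (by positivity) hα
    have h3 := mul_le_mul_of_nonneg_right h2 (pow_nonneg hα0.le 3)
    rw [mul_assoc _ (_ / _), div_mul_cancel₀ _ (by positivity)] at h3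
    have h4 : (‖a‖ * m ^ 2) ^ 3 * ‖(t : F)‖ ^ 3 / r ^ 2 * (max 1 r * Z) ^ 3 =
      (‖a‖ * m ^ 2) ^ 3 / r ^ 2 * (max 1 r * Z) ^ 3 * ‖(t : F)‖ ^ 3 := by ring
    linarith
  · have h0 : innerIntegral μ ψ (ballIndicator c ‖d‖) (ballIndicator e ‖d‖) b α t = 0 := by
      have : ∀ v, kernel ψ (ballIndicator c ‖d‖) (ballIndicator e ‖d‖) b α t v = 0 := by
        intro v
        rw [kernel_eq]
        have : ballIndicator e ‖d‖ (Matrix.of (cellEntries b t v)) = 0 :=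
          if_neg fun hle => ht ((matrix_norm_sub_le_iff _ _ hd'.le).1 hle).2.1
        rw [this, mul_zero, zero_mul]
      simp [innerIntegral, this]
    rw [h0, norm_zero, zero_mul]
    linarith

variable {f₁ f₂ : Matrix (Fin 2) (Fin 2) F → ℂ} {δ M C : ℝ}

/-- The inner integral decays like `|t|³ / |α|³`. -/
lemma exists_innerIntegral_mul_pow_le (h : IsNormalizedUniformizer Q ϖ) (hψ : Continuous ψ)
    {a : F} (ha : IsConductor ψ a) (ha0 : a ≠ 0)
    (h₁ : IsUniformlyLocallyConstant (fun x : Fin 2 → Fin 2 → F => f₁ (Matrix.of x)) δ M C)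
    (h₂ : IsUniformlyLocallyConstant (fun x : Fin 2 → Fin 2 → F => f₂ (Matrix.of x)) δ M C)
    (hδ : 0 < δ) {r : ℝ} (hr : 0 < r) :
    ∃ A : ℝ, ∀ b : F, ‖b‖ = r → ∀ (α : V F) (t : Fˣ),
      ‖innerIntegral μ ψ f₁ f₂ b α t‖ * ‖α‖ ^ 3 ≤ A * ‖(t : F)‖ ^ 3 := by
  obtain ⟨d, hd, hdδ⟩ := h.exists_norm_le hδ
  have hd' : 0 < ‖d‖ := norm_pos_iff.2 hd
  obtain ⟨S₁, hS₁⟩ := (h₁.mono hdδ le_rfl le_rfl).exists_finset hd'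
  obtain ⟨S₂, hS₂⟩ := (h₂.mono hdδ le_rfl le_rfl).exists_finset hd'
  choose A hA using fun c e => exists_innerIntegral_ballIndicator_le (μ := μ) h hψ ha ha0 hd hr c e
  refine ⟨∑ c ∈ S₁, ∑ e ∈ S₂, ‖f₁ (Matrix.of c)‖ * ‖f₂ (Matrix.of e)‖ * A c e,
    fun b hb α t => ?_⟩
  have hsum : innerIntegral μ ψ f₁ f₂ b α t = ∑ c ∈ S₁, ∑ e ∈ S₂, f₁ (Matrix.of c) *
      f₂ (Matrix.of e) *
        innerIntegral μ ψ (ballIndicator c ‖d‖) (ballIndicator e ‖d‖) b α t := by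
    have hint : ∀ c e, Integrable
        (kernel ψ (ballIndicator c ‖d‖) (ballIndicator e ‖d‖) b α t) (volV μ) := fun c e =>
      integrable_kernel hψ ((isUniformlyLocallyConstant_ballIndicator c hd').mono le_rfl
        (le_max_left _ (max ‖e‖ ‖d‖)) le_rfl) ((isUniformlyLocallyConstant_ballIndicator e hd').mono
          le_rfl (le_max_right _ _) le_rfl) b α t
    simp only [innerIntegral, ← integral_const_mul]
    simp_rw [← integral_finsetSum S₂ fun e _ => (hint _ e).const_mul _]
    rw [← integral_finsetSum S₁ fun c _ => integrable_finsetSum S₂ fun e _ =>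
      (hint c e).const_mul _]
    congr 1
    ext v
    rw [kernel_eq]
    have e1 : f₁ (Matrix.of v.1) = ∑ c ∈ S₁, f₁ (Matrix.of c) *
        ballIndicator c ‖d‖ (Matrix.of v.1) :=
      (hS₁ v.1).trans (Finset.sum_congr rfl fun c _ => (mul_boole _ _).symm)
    have e2 : f₂ (Matrix.of (cellEntries b t v)) = ∑ e ∈ S₂, f₂ (Matrix.of e) *
        ballIndicator e ‖d‖ (Matrix.of (cellEntries b t v)) :=
      (hS₂ _).trans (Finset.sum_congr rfl fun c _ => (mul_boole _ _).symm)
    rw [e1, e2, Finset.sum_mul_sum, Finset.sum_mul]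
    refine Finset.sum_congr rfl fun c _ => ?_
    rw [Finset.sum_mul]
    refine Finset.sum_congr rfl fun e _ => ?_
    rw [kernel_eq]
    ring
  rw [hsum, Finset.sum_mul]
  refine (mul_le_mul_of_nonneg_right ((norm_sum_le _ _).trans
    (Finset.sum_le_sum fun c _ => norm_sum_le _ _)) (by positivity)).trans ?_
  rw [Finset.sum_mul]
  refine Finset.sum_le_sum fun c _ => ?_
  rw [Finset.sum_mul, Finset.sum_mul]
  refine Finset.sum_le_sum fun e _ => ?_
  rw [norm_mul, norm_mul, mul_assoc, mul_assoc _ (A c e)]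
  exact mul_le_mul_of_nonneg_left (hA c e b hb α t) (by positivity)

end Decay

/-! ### Topology and Haar measure of the multiplicative group -/

section Units

variable {F : Type*} [NormedField F] [MeasurableSpace F] [BorelSpace F]

/-- The inverse is continuous away from `0`, so the topology of `Fˣ` is induced from `F` and its
Borel sets are pulled back from `F`. -/
instance units_borelSpace : BorelSpace Fˣ where
  measurable_eq := by
    have h1 := congrArg (fun t => @borel Fˣ t) (Units.isEmbedding_val₀ (G₀ := F)).eq_induced
    have h2 := h1.trans borel_comap
    rw [← BorelSpace.measurable_eq (α := F)] at h2
    exact h2.symm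

variable [ProperSpace F]

instance units_secondCountableTopology : SecondCountableTopology Fˣ :=
  (Units.isEmbedding_val₀ (G₀ := F)).secondCountableTopology

instance units_locallyCompactSpace : LocallyCompactSpace Fˣ :=
  (Units.isOpenEmbedding_val (R := F)).locallyCompactSpace

lemma isCompact_annulus {c₁ : ℝ} (hc₁ : 0 < c₁) (c₂ : ℝ) :
    IsCompact {t : Fˣ | c₁ ≤ ‖(t : F)‖ ∧ ‖(t : F)‖ ≤ c₂} := by
  rw [(Units.isEmbedding_val₀ (G₀ := F)).isCompact_iff]
  have : Units.val '' {t : Fˣ | c₁ ≤ ‖(t : F)‖ ∧ ‖(t : F)‖ ≤ c₂} =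
      Metric.closedBall 0 c₂ ∩ {x : F | c₁ ≤ ‖x‖} := by
    ext x
    simp only [Set.mem_image, Set.mem_ofPred_eq, Set.mem_inter_iff, mem_closedBall_zero_iff]
    constructor
    · rintro ⟨t, ⟨h1, h2⟩, rfl⟩
      exact ⟨h2, h1⟩
    · rintro ⟨h2, h1⟩
      exact ⟨Units.mk0 x (norm_pos_iff.1 (hc₁.trans_le h1)), ⟨h1, h2⟩, rfl⟩
  rw [this]
  exact (isCompact_closedBall _ _).inter_right (isClosed_le continuous_const continuous_norm)

variable {Q : ℕ} {ϖ : F}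

lemma measureReal_sphere (h : IsNormalizedUniformizer Q ϖ) (ν : Measure Fˣ) [ν.IsHaarMeasure]
    (n : ℤ) : ν.real {t : Fˣ | ‖(t : F)‖ = (Q : ℝ) ^ n} = ν.real {t : Fˣ | ‖(t : F)‖ = 1} := by
  rw [measureReal_def, measureReal_def,
    ← measure_preimage_mul ν (Units.mk0 ϖ h.ne_zero ^ n) {t : Fˣ | ‖(t : F)‖ = 1}]
  congr 2
  ext t
  have hQ := h.cast_pos
  simp only [Set.mem_ofPred_eq, Set.mem_preimage, Units.val_mul, Units.val_zpow_eq_zpow_val,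
    Units.val_mk0, norm_mul, norm_zpow, h.norm_eq, inv_zpow]
  rw [inv_mul_eq_one₀ (by positivity), eq_comm]

/-- The region is the disjoint union of the shells `|t| = Q ^ (-(n + k))`. All have the same
multiplicative measure, so the integral is a geometric series. -/
lemma integrableOn_norm_rpow (h : IsNormalizedUniformizer Q ϖ) (ν : Measure Fˣ) [ν.IsHaarMeasure]
    {τ : ℝ} (hτ : 0 < τ) (k : ℤ) :
    IntegrableOn (fun t : Fˣ => ‖(t : F)‖ ^ τ) {t | ‖(t : F)‖ ≤ (Q : ℝ) ^ (-k)} ν ∧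
    ∫ t in {t | ‖(t : F)‖ ≤ (Q : ℝ) ^ (-k)}, ‖(t : F)‖ ^ τ ∂ν =
      ν.real {t : Fˣ | ‖(t : F)‖ = 1} * ∑' n : ℕ, (Q : ℝ) ^ (-((n : ℝ) + k) * τ) := by
  have hQ := h.cast_pos
  have hQ1 := h.one_lt_cast
  have hcont : Continuous fun t : Fˣ => ‖(t : F)‖ := by fun_prop
  set s : ℕ → Set Fˣ := fun n => {t | ‖(t : F)‖ = (Q : ℝ) ^ (-((n : ℤ) + k))} with hs
  have hunion : {t : Fˣ | ‖(t : F)‖ ≤ (Q : ℝ) ^ (-k)} = ⋃ n, s n := by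
    ext t
    simp only [hs, Set.mem_ofPred_eq, Set.mem_iUnion]
    obtain ⟨j, hj⟩ := h.exists_norm_eq_zpow t t.ne_zero
    rw [hj, zpow_le_zpow_iff_right₀ hQ1]
    constructor
    · intro hle
      exact ⟨(-k - j).toNat, by congr 1; lia⟩
    · rintro ⟨n, hn⟩
      have := zpow_right_injective₀ hQ hQ1.ne' hn
      lia
  have hmeas : ∀ n, MeasurableSet (s n) := fun n =>
    (isClosed_eq hcont continuous_const).measurableSet
  have hfin : ∀ n, ν (s n) < ⊤ := fun n => by
    refine lt_of_le_of_lt (measure_mono ?_)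
      (isCompact_annulus (F := F) (c₁ := (Q : ℝ) ^ (-((n : ℤ) + k))) (by positivity)
        ((Q : ℝ) ^ (-((n : ℤ) + k)))).measure_lt_top
    intro t ht
    exact ⟨ht.symm.le, ht.le⟩
  have hval : ∀ n : ℕ, Set.EqOn (fun t : Fˣ => ‖(t : F)‖ ^ τ)
      (fun _ => (Q : ℝ) ^ (-((n : ℝ) + k) * τ)) (s n) := by
    intro n t ht
    have ht' : ‖(t : F)‖ = (Q : ℝ) ^ (-((n : ℤ) + k)) := ht
    simp only [ht']
    rw [← Real.rpow_intCast, ← Real.rpow_mul hQ.le]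
    push_cast
    rfl
  have hint : ∀ n : ℕ, ∫ t in s n, ‖(t : F)‖ ^ τ ∂ν =
      ν.real {t : Fˣ | ‖(t : F)‖ = 1} * (Q : ℝ) ^ (-((n : ℝ) + k) * τ) := by
    intro n
    rw [setIntegral_congr_fun (hmeas n) (hval n), setIntegral_const, smul_eq_mul,
      measureReal_sphere h]
  have hsummable : Summable fun n : ℕ => (Q : ℝ) ^ (-((n : ℝ) + k) * τ) := by
    have : (fun n : ℕ => (Q : ℝ) ^ (-((n : ℝ) + k) * τ)) =
        fun n : ℕ => (Q : ℝ) ^ (-(k * τ)) * ((Q : ℝ) ^ (-τ)) ^ n := by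
      ext n
      rw [← Real.rpow_natCast, ← Real.rpow_mul hQ.le, ← Real.rpow_add hQ]
      congr 1; ring
    rw [this]
    exact (summable_geometric_of_lt_one (by positivity)
      (Real.rpow_lt_one_of_one_lt_of_neg hQ1 (by linarith))).mul_left _
  have hOn : IntegrableOn (fun t : Fˣ => ‖(t : F)‖ ^ τ) (⋃ n, s n) ν := by
    refine integrableOn_iUnion_of_summable_integral_norm (fun n => ?_) ?_
    · exact (integrableOn_congr_fun (hval n) (hmeas n)).2
        (integrableOn_const (hfin n).ne (by simp))
    · have : ∀ (t : Fˣ), ‖‖(t : F)‖ ^ τ‖ = ‖(t : F)‖ ^ τ := fun t =>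
        Real.norm_of_nonneg (by positivity)
      simp only [this, hint]
      exact hsummable.mul_left _
  refine ⟨by rwa [hunion], ?_⟩
  rw [hunion, integral_iUnion hmeas ?_ hOn]
  · simp only [hint, tsum_mul_left]
  · intro i j hij
    rw [Function.onFun, Set.disjoint_left]
    intro t ht ht'
    have h1 : (Q : ℝ) ^ (-((i : ℤ) + k)) = (Q : ℝ) ^ (-((j : ℤ) + k)) := ht.symm.trans ht'
    have := zpow_right_injective₀ hQ hQ1.ne' h1
    exact hij (by lia)

end Units

/-! ### The Mellin transform: convergence, bound and vanishing -/

section Mellin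

variable {F : Type*} [NormedField F]

lemma norm_twist (χ : Fˣ → Circle) (s : ℂ) (t : Fˣ) : ‖twist χ s t‖ = ‖(t : F)‖ ^ s.re := by
  rw [twist, norm_mul, Circle.norm_coe, one_mul,
    Complex.norm_cpow_eq_rpow_re_of_pos (norm_pos_iff.2 t.ne_zero)]

lemma continuous_twist {χ : Fˣ → Circle} (hχ : Continuous χ) (s : ℂ) :
    Continuous (twist (F := F) χ s) := by
  unfold twist
  refine Continuous.mul (by fun_prop) (Continuous.cpow (by fun_prop) continuous_const fun t => ?_)
  exact Complex.ofReal_mem_slitPlane.2 (norm_pos_iff.2 t.ne_zero)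

variable [IsUltrametricDist F] [ProperSpace F] [MeasurableSpace F]
  [BorelSpace F] {Q : ℕ} {ϖ : F} {μ : Measure F} [μ.IsAddHaarMeasure] {ν : Measure Fˣ}
  [ν.IsHaarMeasure] {ψ : AddChar F Circle} {f₁ f₂ : Matrix (Fin 2) (Fin 2) F → ℂ} {δ M C : ℝ}

lemma integrable_kernel_mul_twist (h : IsNormalizedUniformizer Q ϖ) (hψ : Continuous ψ)
    (h₁ : IsUniformlyLocallyConstant (fun x : Fin 2 → Fin 2 → F => f₁ (Matrix.of x)) δ M C)
    (h₂ : IsUniformlyLocallyConstant (fun x : Fin 2 → Fin 2 → F => f₂ (Matrix.of x)) δ M C)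
    (b : F) (α : V F) {χ : Fˣ → Circle} (hχ : Continuous χ) {s : ℂ} (hs : 0 < s.re) :
    Integrable (fun p : Fˣ × V F => kernel ψ f₁ f₂ b α p.1 p.2 * twist χ s p.1)
      (ν.prod (volV μ)) := by
  have hQ1 := h.one_lt_cast
  obtain ⟨N, hN⟩ := pow_unbounded_of_one_lt M hQ1
  set T : Set Fˣ := {t | ‖(t : F)‖ ≤ (Q : ℝ) ^ (-(-(N : ℤ)))} with hT
  have hTm : MeasurableSet T := (isClosed_le (by fun_prop) continuous_const).measurableSet
  have i1 : Integrable (T.indicator fun t : Fˣ => ‖(t : F)‖ ^ s.re) ν :=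
    (integrable_indicator_iff hTm).2 (integrableOn_norm_rpow h ν hs _).1
  have i2 : Integrable ((Metric.closedBall (0 : V F) M).indicator fun _ => C ^ 2) (volV μ) :=
    (integrable_indicator_iff Metric.isClosed_closedBall.measurableSet).2
      (integrableOn_const (isCompact_closedBall _ _).measure_lt_top.ne (by simp))
  refine (i1.mul_prod i2).mono' ?_ (Filter.Eventually.of_forall fun p => ?_)
  · exact ((continuous_kernel hψ h₁.continuous h₂.continuous b α).mul
      ((continuous_twist hχ s).comp continuous_fst)).aestronglyMeasurable
  · by_cases hne : kernel ψ f₁ f₂ b α p.1 p.2 = 0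
    · rw [hne, zero_mul, norm_zero]
      exact mul_nonneg (Set.indicator_nonneg (fun t _ => by positivity) _)
        (Set.indicator_nonneg (fun t _ => by positivity) _)
    · obtain ⟨hv, ht⟩ := norm_le_of_kernel_ne_zero h₁ h₂ hne
      have ht' : p.1 ∈ T := by
        rw [hT, neg_neg, zpow_natCast]; exact ht.trans hN.le
      rw [Set.indicator_of_mem ht', Set.indicator_of_mem (by simpa using hv), norm_mul, norm_twist,
        mul_comm]
      exact mul_le_mul_of_nonneg_left (norm_kernel_le h₁ h₂ b α _ _) (by positivity)

lemma aestronglyMeasurable_outerIntegrand (hψ : Continuous ψ)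
    (h₁ : IsUniformlyLocallyConstant (fun x : Fin 2 → Fin 2 → F => f₁ (Matrix.of x)) δ M C)
    (h₂ : IsUniformlyLocallyConstant (fun x : Fin 2 → Fin 2 → F => f₂ (Matrix.of x)) δ M C)
    (b : F) (α : V F) {χ : Fˣ → Circle} (hχ : Continuous χ) (s : ℂ) :
    AEStronglyMeasurable (outerIntegrand μ ψ f₁ f₂ b α χ s) ν := by
  refine AEStronglyMeasurable.mul ?_ (continuous_twist hχ s).aestronglyMeasurable
  exact ((continuous_kernel hψ h₁.continuous h₂.continuous b
    α).stronglyMeasurable.integral_prod_right' (ν := volV μ)).aestronglyMeasurable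

/-- Cubic decay bounds the product with `|α|³`; the other factor `|α|³` is at most `|R|³` wherever
the inner integral can be nonzero. -/
lemma exists_innerIntegral_mul_pow_six_le (h : IsNormalizedUniformizer Q ϖ) (hψ : Continuous ψ)
    {a : F} (ha : IsConductor ψ a) (ha0 : a ≠ 0)
    (h₁ : IsUniformlyLocallyConstant (fun x : Fin 2 → Fin 2 → F => f₁ (Matrix.of x)) δ M C)
    (h₂ : IsUniformlyLocallyConstant (fun x : Fin 2 → Fin 2 → F => f₂ (Matrix.of x)) δ M C)
    (hδ : 0 < δ) (hδM : δ ≤ M) {r : ℝ} (hr : 0 < r) :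
    ∃ A : ℝ, 0 ≤ A ∧ ∀ b : F, ‖b‖ = r → ∀ (α : V F) (t : Fˣ),
      ‖innerIntegral μ ψ f₁ f₂ b α t‖ * ‖α‖ ^ 6 ≤ A * ‖(t : F)‖ ^ 3 := by
  obtain ⟨A, hA⟩ := exists_innerIntegral_mul_pow_le (μ := μ) h hψ ha ha0 h₁ h₂ hδ hr
  obtain ⟨R, hR⟩ := exists_innerIntegral_eq_zero (μ := μ) h ha h₁ h₂ hδ hδM r
  refine ⟨|A| * |R| ^ 3, by positivity, fun b hb α t => ?_⟩
  rcases lt_or_ge R ‖α‖ with hα | hα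
  · rw [hR b hb α t hα, norm_zero, zero_mul]; positivity
  · calc ‖innerIntegral μ ψ f₁ f₂ b α t‖ * ‖α‖ ^ 6
        = ‖innerIntegral μ ψ f₁ f₂ b α t‖ * ‖α‖ ^ 3 * ‖α‖ ^ 3 := by ring
      _ ≤ (|A| * ‖(t : F)‖ ^ 3) * |R| ^ 3 := by
          refine mul_le_mul ((hA b hb α t).trans ?_)
            (pow_le_pow_left₀ (norm_nonneg _) (hα.trans (le_abs_self R)) 3) (by positivity)
            (by positivity)
          exact mul_le_mul_of_nonneg_right (le_abs_self A) (by positivity)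
      _ = _ := by ring

/-- The shell `|t| = Q⁻¹` gives `Q ^ (-σ)`; the shells `|t| = Q ^ j`, `0 ≤ j ≤ N`, give at most `Q ^
(N max(0, σ))`. -/
lemma rpow_norm_le (h : IsNormalizedUniformizer Q ϖ) {t : F} {N : ℕ}
    (ht1 : (Q : ℝ) ^ (-1 : ℤ) ≤ ‖t‖) (ht2 : ‖t‖ ≤ (Q : ℝ) ^ (N : ℤ)) (σ : ℝ) :
    ‖t‖ ^ σ ≤ (Q : ℝ) ^ ((N : ℝ) * max 0 σ) * (1 + (Q : ℝ) ^ (-σ)) := by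
  have hQ := h.cast_pos
  have hQ1 := h.one_lt_cast
  have ht0 : t ≠ 0 := norm_pos_iff.1 (lt_of_lt_of_le (by positivity) ht1)
  obtain ⟨j, hj⟩ := h.exists_norm_eq_zpow t ht0
  rw [hj, zpow_le_zpow_iff_right₀ hQ1] at ht1 ht2
  rw [hj, ← Real.rpow_intCast, ← Real.rpow_mul hQ.le]
  have hmax : 0 ≤ max 0 σ := le_max_left _ _
  rcases eq_or_lt_of_le ht1 with h1 | h1
  · rw [← h1]
    have h2 : (1 : ℝ) ≤ (Q : ℝ) ^ ((N : ℝ) * max 0 σ) :=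
      Real.one_le_rpow hQ1.le (by positivity)
    have h3 : ((-1 : ℤ) : ℝ) * σ = -σ := by push_cast; ring
    rw [h3]
    have h4 : 0 < (Q : ℝ) ^ (-σ) := by positivity
    nlinarith
  · have hj0 : (0 : ℝ) ≤ j := by exact_mod_cast (by lia : (0 : ℤ) ≤ j)
    have hjN : (j : ℝ) ≤ N := by exact_mod_cast ht2
    have h2 : (j : ℝ) * σ ≤ N * max 0 σ :=
      (mul_le_mul_of_nonneg_left (le_max_right 0 σ) hj0).trans
        (mul_le_mul_of_nonneg_right hjN hmax)
    refine (Real.rpow_le_rpow_of_exponent_le hQ1.le h2).trans ?_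
    refine le_mul_of_one_le_right (by positivity) ?_
    have : 0 < (Q : ℝ) ^ (-σ) := by positivity
    linarith

/-- Convergence and bound of the Mellin transform for `Re s > -3`. -/
lemma exists_orbitalMellin_le (h : IsNormalizedUniformizer Q ϖ) (hψ : Continuous ψ)
    {a : F} (ha : IsConductor ψ a) (ha0 : a ≠ 0)
    (h₁ : IsUniformlyLocallyConstant (fun x : Fin 2 → Fin 2 → F => f₁ (Matrix.of x)) δ M C)
    (h₂ : IsUniformlyLocallyConstant (fun x : Fin 2 → Fin 2 → F => f₂ (Matrix.of x)) δ M C)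
    (hδ : 0 < δ) (hδM : δ ≤ M) {r : ℝ} (hr : 0 < r) :
    ∃ (A : ℝ) (m : ℕ), ∀ b : F, ‖b‖ = r → ∀ α : V F, α ≠ 0 → ∀ (χ : Fˣ → Circle) (s : ℂ),
      Continuous χ → -3 < s.re → Integrable (outerIntegrand μ ψ f₁ f₂ b α χ s) ν ∧
        ‖orbitalMellin μ ν ψ f₁ f₂ b α χ s‖ ≤ A * (Q : ℝ) ^ ((m : ℝ) * max 0 s.re) *
          (1 + (Q : ℝ) ^ (-s.re) +
            (‖α‖ ^ 6)⁻¹ * ∑' n : ℕ, (Q : ℝ) ^ (-((n : ℝ) + 2) * (3 + s.re))) := by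
  have hQ := h.cast_pos
  have hQ1 := h.one_lt_cast
  obtain ⟨A, hA0, hA⟩ :=
    exists_innerIntegral_mul_pow_six_le (μ := μ) h hψ ha ha0 h₁ h₂ hδ hδM hr
  obtain ⟨N, hN⟩ := pow_unbounded_of_one_lt M hQ1
  set C₀ := C ^ 2 * (volV μ).real (Metric.closedBall 0 M) with hC₀
  have hC₀0 : 0 ≤ C₀ := by positivity
  -- The trivial bound is used on `S₁` and decay on `S₂`. No `t` with `|t| ≤ M` is missed, because
  -- `M < Q ^ N` and norms are integral powers of `Q`.
  set S₁ : Set Fˣ := {t | (Q : ℝ) ^ (-1 : ℤ) ≤ ‖(t : F)‖ ∧ ‖(t : F)‖ ≤ (Q : ℝ) ^ (N : ℤ)} with hS₁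
  set S₂ : Set Fˣ := {t | ‖(t : F)‖ ≤ (Q : ℝ) ^ (-(2 : ℤ))} with hS₂
  set U : ℝ := ν.real {t : Fˣ | ‖(t : F)‖ = 1} with hU
  have hU0 : 0 ≤ U := measureReal_nonneg
  have hS₁c : IsCompact S₁ := isCompact_annulus (by positivity) _
  have hS₂m : MeasurableSet S₂ := (isClosed_le (by fun_prop) continuous_const).measurableSet
  refine ⟨C₀ * ν.real S₁ + A * U, N, fun b hb α hα χ s hχ hs => ?_⟩
  have hα0 : 0 < ‖α‖ := norm_pos_iff.2 hα
  set σ := s.re with hσ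
  set P := (Q : ℝ) ^ ((N : ℝ) * max 0 σ) with hP
  have hP1 : 1 ≤ P := Real.one_le_rpow hQ1.le (mul_nonneg (by positivity) (le_max_left _ _))
  have hτ : 0 < 3 + σ := by linarith
  obtain ⟨i2, e2⟩ := integrableOn_norm_rpow h ν hτ 2
  have i1 : IntegrableOn (fun _ : Fˣ => C₀ * (P * (1 + (Q : ℝ) ^ (-σ)))) S₁ ν :=
    integrableOn_const hS₁c.measure_lt_top.ne enorm_ne_top
  have i2' := i2.const_mul (A * (‖α‖ ^ 6)⁻¹)
  have hbi := ((integrable_indicator_iff hS₁c.isClosed.measurableSet).2 i1).add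
    ((integrable_indicator_iff hS₂m).2 i2')
  have hle : ∀ t, ‖outerIntegrand μ ψ f₁ f₂ b α χ s t‖ ≤
      (S₁.indicator (fun _ : Fˣ => C₀ * (P * (1 + (Q : ℝ) ^ (-σ)))) +
        S₂.indicator fun t : Fˣ => A * (‖α‖ ^ 6)⁻¹ * ‖(t : F)‖ ^ (3 + σ)) t := by
    intro t
    have ht0 : 0 < ‖(t : F)‖ := norm_pos_iff.2 t.ne_zero
    have hn1 : 0 ≤ S₁.indicator (fun _ : Fˣ => C₀ * (P * (1 + (Q : ℝ) ^ (-σ)))) t :=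
      Set.indicator_nonneg (fun t _ => by positivity) _
    have hn2 : 0 ≤ S₂.indicator (fun t : Fˣ => A * (‖α‖ ^ 6)⁻¹ * ‖(t : F)‖ ^ (3 + σ)) t :=
      Set.indicator_nonneg (fun t _ => by positivity) _
    have he : outerIntegrand μ ψ f₁ f₂ b α χ s t =
      innerIntegral μ ψ f₁ f₂ b α t * twist χ s t := rfl
    rw [Pi.add_apply, he, norm_mul, norm_twist]
    rcases lt_or_ge M ‖(t : F)‖ with htM | htM
    · rw [innerIntegral_eq_zero_of_lt_norm h₁ h₂ htM, norm_zero, zero_mul]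
      exact add_nonneg hn1 hn2
    by_cases ht1 : (Q : ℝ) ^ (-1 : ℤ) ≤ ‖(t : F)‖
    · have ht2 : ‖(t : F)‖ ≤ (Q : ℝ) ^ (N : ℤ) := by rw [zpow_natCast]; exact htM.trans hN.le
      have hmem : t ∈ S₁ := ⟨ht1, ht2⟩
      rw [Set.indicator_of_mem hmem]
      refine le_add_of_le_of_nonneg ?_ hn2
      exact mul_le_mul (norm_innerIntegral_le h₁ h₂ b α t) (rpow_norm_le h ht1 ht2 σ)
        (by positivity) hC₀0
    · have hmem : t ∈ S₂ := by
        obtain ⟨j, hj⟩ := h.exists_norm_eq_zpow t t.ne_zero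
        rw [hS₂, Set.mem_ofPred_eq, hj, zpow_le_zpow_iff_right₀ hQ1]
        rw [hj, zpow_le_zpow_iff_right₀ hQ1] at ht1
        lia
      rw [Set.indicator_of_mem hmem]
      refine le_add_of_nonneg_of_le hn1 ?_
      rw [Real.rpow_add ht0, ← mul_assoc]
      refine mul_le_mul_of_nonneg_right ?_ (by positivity)
      have h3 : ‖(t : F)‖ ^ (3 : ℝ) = ‖(t : F)‖ ^ 3 := by norm_cast
      rw [h3, mul_right_comm, ← div_eq_mul_inv, le_div_iff₀ (by positivity)]
      exact hA b hb α t
  refine ⟨hbi.mono' (aestronglyMeasurable_outerIntegrand hψ h₁ h₂ b α hχ s)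
    (Filter.Eventually.of_forall hle), ?_⟩
  refine (norm_integral_le_of_norm_le hbi (Filter.Eventually.of_forall hle)).trans ?_
  rw [integral_add' ((integrable_indicator_iff hS₁c.isClosed.measurableSet).2 i1)
    ((integrable_indicator_iff hS₂m).2 i2'), integral_indicator hS₁c.isClosed.measurableSet,
    integral_indicator hS₂m, setIntegral_const, integral_const_mul, e2, smul_eq_mul]
  push_cast
  set Y := ∑' n : ℕ, (Q : ℝ) ^ (-((n : ℝ) + 2) * (3 + σ)) with hY
  have hY0 : 0 ≤ Y := tsum_nonneg fun n => by positivity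
  have hν : 0 ≤ ν.real S₁ := measureReal_nonneg
  have hq : 0 ≤ (Q : ℝ) ^ (-σ) := by positivity
  have hX : 0 ≤ (‖α‖ ^ 6)⁻¹ * Y := by positivity
  have t1 : 0 ≤ C₀ * ν.real S₁ * P * ((‖α‖ ^ 6)⁻¹ * Y) := by positivity
  have t2 : 0 ≤ A * U * P * (1 + (Q : ℝ) ^ (-σ)) := by positivity
  -- The tail term comes without the factor `P`, which may be inserted since `P ≥ 1`.
  have t3 : 0 ≤ A * U * ((‖α‖ ^ 6)⁻¹ * Y) * (P - 1) :=
    mul_nonneg (by positivity) (by linarith)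
  nlinarith

lemma orbitalMellin_eq_zero_of_innerIntegral {b : F} {α : V F}
    (hz : ∀ t, innerIntegral μ ψ f₁ f₂ b α t = 0) (χ : Fˣ → Circle) (s : ℂ) :
    orbitalMellin μ ν ψ f₁ f₂ b α χ s = 0 := by
  have : ∀ t, outerIntegrand μ ψ f₁ f₂ b α χ s t = 0 := fun t => by
    change innerIntegral μ ψ f₁ f₂ b α t * twist χ s t = 0
    rw [hz, zero_mul]
  simp [orbitalMellin, this]

/-- The substitution `t ↦ u t` preserves `ν` and multiplies the integrand by `χ u ≠ 1`. No
convergence is needed. -/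
lemma orbitalMellin_eq_zero_of_unit
    (h₁ : IsUniformlyLocallyConstant (fun x : Fin 2 → Fin 2 → F => f₁ (Matrix.of x)) δ M C)
    (h₂ : IsUniformlyLocallyConstant (fun x : Fin 2 → Fin 2 → F => f₂ (Matrix.of x)) δ M C)
    (b : F) (α : V F) (χ : Fˣ →* Circle) (s : ℂ) {u : Fˣ} (hu : ‖(u : F)‖ = 1)
    (hu1 : ‖(u : F) - 1‖ * M ≤ δ) (hχu : χ u ≠ 1) :
    orbitalMellin μ ν ψ f₁ f₂ b α χ s = 0 := by
  have h1 : ∀ t, outerIntegrand μ ψ f₁ f₂ b α χ s (u * t) =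
      (χ u : ℂ) * outerIntegrand μ ψ f₁ f₂ b α χ s t := by
    intro t
    change innerIntegral μ ψ f₁ f₂ b α (u * t) * twist χ s (u * t) =
      (χ u : ℂ) * (innerIntegral μ ψ f₁ f₂ b α t * twist χ s t)
    rw [innerIntegral_unit_mul h₁ h₂ b α t hu hu1, twist, twist, map_mul, Circle.coe_mul,
      Units.val_mul, norm_mul, hu, one_mul]
    ring
  have h2 := integral_mul_left_eq_self (μ := ν) (outerIntegrand μ ψ f₁ f₂ b α χ s) u
  simp_rw [h1, integral_const_mul] at h2
  have h3 : ((χ u : ℂ) - 1) * orbitalMellin μ ν ψ f₁ f₂ b α χ s = 0 := by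
    rw [sub_mul, one_mul, orbitalMellin, h2, sub_self]
  refine (mul_eq_zero.1 h3).resolve_left (sub_ne_zero.2 fun h4 => hχu (Circle.ext ?_))
  simpa using h4

end Mellin

/-! ### Completions of number fields as normalized fields -/

section NumberFieldPlace

variable {K : Type*} [Field K] [NumberField K] (w : HeightOneSpectrum (𝓞 K))

lemma one_lt_q : 1 < q w := NumberField.HeightOneSpectrum.one_lt_absNorm w

lemma norm_eq_zpow_log {x : w.adicCompletion K} (hx : x ≠ 0) :
    ‖x‖ = (q w : ℝ) ^ WithZero.log (Valued.v x) := by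
  rw [NumberField.FinitePlace.norm_def, WithZeroMulInt.toNNReal_neg_apply _
    ((Valuation.ne_zero_iff _).2 hx)]
  rw [WithZero.toAdd_unzero_eq_log]
  push_cast
  rfl

lemma ord_eq_of_norm_eq {x : w.adicCompletion K} {n : ℤ} (hx : ‖x‖ = (q w : ℝ) ^ (-n)) :
    ord w x = (n : WithTop ℤ) := by
  have hq : (1 : ℝ) < q w := by exact_mod_cast one_lt_q w
  have hq0 : (0 : ℝ) < q w := by linarith
  have hx0 : x ≠ 0 := by
    rw [← norm_ne_zero_iff, hx]; positivity
  rw [norm_eq_zpow_log w hx0] at hx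
  have := zpow_right_injective₀ hq0 hq.ne' hx
  rw [ord, if_neg hx0, this, neg_neg]

lemma le_ord_iff {x : w.adicCompletion K} {n : ℤ} :
    (n : WithTop ℤ) ≤ ord w x ↔ ‖x‖ ≤ (q w : ℝ) ^ (-n) := by
  have hq : (1 : ℝ) < q w := by exact_mod_cast one_lt_q w
  rcases eq_or_ne x 0 with rfl | hx
  · simp only [ord, if_true, le_top, norm_zero, true_iff]; positivity
  · have h1 := norm_eq_zpow_log w hx
    rw [ord_eq_of_norm_eq w (n := -WithZero.log (Valued.v x)) (by rw [neg_neg, h1]), h1,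
      WithTop.coe_le_coe, zpow_le_zpow_iff_right₀ hq]
    constructor <;> intro h <;> linarith

/-- Lifts of the classes of `𝓞 K` modulo `w` serve as representatives: a difference outside `w` has
norm one. They suffice because `K` is dense in the completion and every `w`-integral element of `K`
is congruent to one of `𝓞 K`. -/
lemma exists_residues :
    ∃ S : Finset (w.adicCompletion K), S.card = q w ∧ (∀ s ∈ S, ‖s‖ ≤ 1) ∧
      (∀ s ∈ S, ∀ s' ∈ S, s ≠ s' → ‖s - s'‖ = 1) ∧
      ∀ x : w.adicCompletion K, ‖x‖ ≤ 1 → ∃ s ∈ S, ‖x - s‖ < 1 := by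
  classical
  have hfin : Finite (𝓞 K ⧸ w.asIdeal) := w.asIdeal.finiteQuotientOfFreeOfNeBot w.ne_bot
  have := Fintype.ofFinite (𝓞 K ⧸ w.asIdeal)
  let ι : 𝓞 K → w.adicCompletion K := fun a =>
    NumberField.FinitePlace.embedding w (algebraMap (𝓞 K) K a)
  have hsub : ∀ a b, ι a - ι b = ι (a - b) := fun a b => by simp [ι]
  let g : 𝓞 K ⧸ w.asIdeal → w.adicCompletion K := fun z => ι (Quotient.out z)
  have hmk : ∀ z : 𝓞 K ⧸ w.asIdeal, Ideal.Quotient.mk w.asIdeal (Quotient.out z) = z :=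
    fun z => Quotient.out_eq z
  have hdist : ∀ z z', z ≠ z' → ‖g z - g z'‖ = 1 := by
    intro z z' hne
    rw [hsub, NumberField.FinitePlace.norm_eq_one_iff_notMem]
    intro hmem
    apply hne
    rw [← hmk z, ← hmk z']
    exact Ideal.Quotient.eq.2 hmem
  have hinj : Function.Injective g := by
    intro z z' h
    by_contra hne
    have := hdist z z' hne
    rw [h, sub_self, norm_zero] at this
    exact zero_ne_one this
  refine ⟨Finset.univ.image g, ?_, ?_, ?_, ?_⟩
  · rw [Finset.card_image_of_injective _ hinj, Finset.card_univ, q, Ideal.absNorm_apply,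
      Submodule.cardQuot_apply, Nat.card_eq_fintype_card]
  · intro s hs
    obtain ⟨z, -, rfl⟩ := Finset.mem_image.1 hs
    exact NumberField.FinitePlace.norm_le_one K w _
  · intro s hs s' hs' hne
    obtain ⟨z, -, rfl⟩ := Finset.mem_image.1 hs
    obtain ⟨z', -, rfl⟩ := Finset.mem_image.1 hs'
    exact hdist z z' fun h => hne (by rw [h])
  · intro x hx
    obtain ⟨_, hk, k, rfl⟩ := Metric.dense_iff.1
      (HeightOneSpectrum.denseRange_algebraMap (K := K) (v := w)) x 1 one_pos
    have hιk : algebraMap K (w.adicCompletion K) k = NumberField.FinitePlace.embedding w k := rfl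
    rw [Metric.mem_ball, dist_eq_norm, hιk] at hk
    have hval : ∀ y : K, Valued.v (NumberField.FinitePlace.embedding w y) = w.valuation K y :=
      fun y => HeightOneSpectrum.valuedAdicCompletion_eq_valuation' w y
    have hk1 : w.valuation K k ≤ 1 := by
      rw [← hval, ← Valued.toNormedField.norm_le_one_iff]
      rw [← sub_add_cancel (NumberField.FinitePlace.embedding w k) x]
      exact (IsUltrametricDist.norm_add_le_max _ _).trans (max_le hk.le hx)
    obtain ⟨a, ha⟩ := HeightOneSpectrum.exists_valuation_sub_lt_of_integer w hk1 1
    rw [← hval, map_sub, Units.val_one, ← Valued.toNormedField.norm_lt_one_iff] at ha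
    refine ⟨g (Ideal.Quotient.mk w.asIdeal a), Finset.mem_image_of_mem g (Finset.mem_univ _), ?_⟩
    have h3 : ‖ι a - g (Ideal.Quotient.mk w.asIdeal a)‖ < 1 := by
      rw [hsub, NumberField.FinitePlace.norm_lt_one_iff_mem]
      exact Ideal.Quotient.eq.1 (hmk _).symm
    have e : x - g (Ideal.Quotient.mk w.asIdeal a) =
        -(NumberField.FinitePlace.embedding w k - x) + (-(ι a -
          NumberField.FinitePlace.embedding w k) +
          (ι a - g (Ideal.Quotient.mk w.asIdeal a))) := by ring
    rw [e]
    refine (IsUltrametricDist.norm_add_le_max _ _).trans_lt (max_lt ?_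
      ((IsUltrametricDist.norm_add_le_max _ _).trans_lt (max_lt ?_ h3)))
    · rwa [norm_neg]
    · rwa [norm_neg]

instance adicCompletion_properSpace : ProperSpace (w.adicCompletion K) := by
  rw [Valued.integer.properSpace_iff_completeSpace_and_isDiscreteValuationRing_integer_and_finite_residueField]
  refine ⟨inferInstance, inferInstanceAs (IsDiscreteValuationRing (w.adicCompletionIntegers K)), ?_⟩
  obtain ⟨S, -, hS1, -, hS⟩ := exists_residues w
  let f : S → IsLocalRing.ResidueField (Valued.integer (w.adicCompletion K)) := fun s =>
    IsLocalRing.residue _ ⟨s.1, Valued.toNormedField.norm_le_one_iff.1 (hS1 s.1 s.2)⟩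
  refine Finite.of_surjective f fun y => ?_
  obtain ⟨x, rfl⟩ := IsLocalRing.residue_surjective y
  obtain ⟨s, hs, hxs⟩ := hS x (Valued.toNormedField.norm_le_one_iff.2 x.2)
  refine ⟨⟨s, hs⟩, ?_⟩
  rw [eq_comm, ← sub_eq_zero, ← map_sub, IsLocalRing.residue_eq_zero_iff,
    IsLocalRing.mem_maximalIdeal, mem_nonunits_iff,
    Valuation.Integer.not_isUnit_iff_valuation_lt_one]
  exact Valued.toNormedField.norm_lt_one_iff.1 hxs

lemma exists_isNormalizedUniformizer :
    ∃ ϖ : w.adicCompletion K, IsNormalizedUniformizer (q w) ϖ := by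
  have hq : (1 : ℝ) < q w := by exact_mod_cast one_lt_q w
  have hq0 : (0 : ℝ) < q w := by linarith
  have hex : ∀ x : w.adicCompletion K, x ≠ 0 → ∃ n : ℤ, ‖x‖ = (q w : ℝ) ^ n :=
    fun x hx => ⟨_, norm_eq_zpow_log w hx⟩
  obtain ⟨ϖ, hϖ⟩ := HeightOneSpectrum.valuedAdicCompletion_surjective K w
    (WithZero.exp (-1 : ℤ))
  have hϖ0 : ϖ ≠ 0 := by
    rintro rfl
    rw [map_zero] at hϖ
    exact WithZero.exp_ne_zero hϖ.symm
  have hn : ‖ϖ‖ = (q w : ℝ)⁻¹ := by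
    rw [norm_eq_zpow_log w hϖ0, hϖ, WithZero.log_exp, zpow_neg_one]
  obtain ⟨S, h1, h2, h3, h4⟩ := exists_residues w
  refine ⟨ϖ, one_lt_q w, hn, hex, S, h1, h2, h3, fun x hx => ?_⟩
  obtain ⟨s, hs, hxs⟩ := h4 x hx
  refine ⟨s, hs, ?_⟩
  -- As the norm is discrete, `< 1` improves to `≤ |ϖ|`.
  rcases eq_or_ne (x - s) 0 with h0 | h0
  · rw [h0, norm_zero]; exact norm_nonneg _
  · obtain ⟨n, hn'⟩ := hex _ h0
    rw [hn', ← zpow_zero (q w : ℝ), zpow_lt_zpow_iff_right₀ hq] at hxs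
    rw [hn', hn, ← zpow_neg_one]
    exact zpow_le_zpow_right₀ hq.le (by lia)

lemma zpow_minOrd_eq {α : V (w.adicCompletion K)} (hα : α ≠ 0) :
    (q w : ℝ) ^ (6 * (minOrd w α).untopD 0) = (‖α‖ ^ 6)⁻¹ := by
  have hq : (1 : ℝ) < q w := by exact_mod_cast one_lt_q w
  have hle : ∀ n : ℤ, (n : WithTop ℤ) ≤ minOrd w α ↔ ‖α‖ ≤ (q w : ℝ) ^ (-n) := by
    intro n
    rw [norm_eq_max]
    simp only [minOrd, le_min_iff, max_le_iff, le_ord_iff]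
  -- Here `c` only serves to show that `|α|` is an integral power of `q`. The minimal valuation is
  -- then finite, so the default of `untopD` is not reached.
  obtain ⟨c, hc, -⟩ := exists_pairing_eq_mul α
  have hc0 : c ≠ 0 := by
    rw [← norm_ne_zero_iff, hc]; exact norm_ne_zero_iff.2 hα
  have hα' := norm_eq_zpow_log w hc0
  set j := WithZero.log (Valued.v c)
  rw [hc] at hα'
  have hiff : ∀ n : ℤ, (n : WithTop ℤ) ≤ minOrd w α ↔ n ≤ -j := by
    intro n
    rw [hle, hα', zpow_le_zpow_iff_right₀ hq, le_neg]
  have hmin : minOrd w α = ((-j : ℤ) : WithTop ℤ) := by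
    induction hm : minOrd w α with
    | top =>
      have := (hiff (-j + 1)).1 (by rw [hm]; exact le_top)
      lia
    | coe m =>
      have h1 := (hiff m).1 hm.ge
      have h2 := (hiff (-j)).2 le_rfl
      rw [hm, WithTop.coe_le_coe] at h2
      rw [le_antisymm h1 h2]
  rw [hmin, WithTop.untopD_coe, hα', ← zpow_natCast, ← zpow_mul, ← zpow_neg]
  congr 1
  push_cast
  ring

end NumberFieldPlace

end RamifiedOrbital

end

theorem proposition3p2 {K : Type*} [Field K] [NumberField K] (w : HeightOneSpectrum (𝓞 K))
    [MeasurableSpace (w.adicCompletion K)] [BorelSpace (w.adicCompletion K)]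
    (μ : Measure (w.adicCompletion K)) [μ.IsAddHaarMeasure]
    (ν : Measure (w.adicCompletion K)ˣ) [ν.IsHaarMeasure]
    (ψ : AddChar (w.adicCompletion K) Circle) (hψ : Continuous ψ) (hψ1 : ψ ≠ 1)
    (f₁ f₂ : Matrix (Fin 2) (Fin 2) (w.adicCompletion K) → ℂ)
    (hf₁ : RamifiedOrbital.IsTestFunction f₁) (hf₂ : RamifiedOrbital.IsTestFunction f₂) :
    -- absolute convergence of the inner integral, and of the whole integral for `Re s > 0`
    (∀ (b : w.adicCompletion K) (α : RamifiedOrbital.V (w.adicCompletion K)), b ≠ 0 →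
      (∀ t : (w.adicCompletion K)ˣ,
        Integrable (RamifiedOrbital.kernel ψ f₁ f₂ b α t) (RamifiedOrbital.volV μ)) ∧
      ∀ (χ : (w.adicCompletion K)ˣ →* Circle) (s : ℂ), Continuous χ → 0 < s.re →
        Integrable
          (fun p : (w.adicCompletion K)ˣ × RamifiedOrbital.V (w.adicCompletion K) =>
            RamifiedOrbital.kernel ψ f₁ f₂ b α p.1 p.2 * RamifiedOrbital.twist χ s p.1)
          (ν.prod (RamifiedOrbital.volV μ))) ∧
    -- the constants below depend on `b` only through `r = |b|`
    ∀ r : ℝ, 0 < r →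
      -- convergence and bound for `Re s > -3`
      (∃ (C : ℝ) (m : ℕ), ∀ (b : w.adicCompletion K), ‖b‖ = r →
        ∀ α ∈ RamifiedOrbital.V' (w.adicCompletion K),
        ∀ (χ : (w.adicCompletion K)ˣ →* Circle) (s : ℂ), Continuous χ → -3 < s.re →
          Integrable (RamifiedOrbital.outerIntegrand μ ψ f₁ f₂ b α χ s) ν ∧
          ‖RamifiedOrbital.orbitalMellin μ ν ψ f₁ f₂ b α χ s‖ ≤
            C * (RamifiedOrbital.q w : ℝ) ^ ((m : ℝ) * max 0 s.re) *
              RamifiedOrbital.majorant w α s.re) ∧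
      -- vanishing
      ∃ R : ℝ, ∀ (b : w.adicCompletion K), ‖b‖ = r →
        ∀ (α : RamifiedOrbital.V (w.adicCompletion K)) (χ : (w.adicCompletion K)ˣ →* Circle)
          (s : ℂ), Continuous χ →
          (0 < s.re ∨ α ∈ RamifiedOrbital.V' (w.adicCompletion K) ∧ -3 < s.re) →
          (R < ‖α.2.1‖ ∨ R < ‖α.2.2‖ ∨ R < RamifiedOrbital.matNorm α ∨
            R < RamifiedOrbital.conductorNorm w χ) →
          RamifiedOrbital.orbitalMellin μ ν ψ f₁ f₂ b α χ s = 0 := by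
  classical
  obtain ⟨ϖ, h⟩ := RamifiedOrbital.exists_isNormalizedUniformizer w
  obtain ⟨a, ha0, ha⟩ := RamifiedOrbital.exists_conductor h ψ hψ hψ1
  obtain ⟨δ₁, hδ₁, M₁, C₁, hu₁⟩ := hf₁.exists_isUniformlyLocallyConstant
  obtain ⟨δ₂, hδ₂, M₂, C₂, hu₂⟩ := hf₂.exists_isUniformlyLocallyConstant
  set δ := min δ₁ δ₂
  -- Including `δ` gives `δ ≤ M`, so translations of size `δ` preserve the ball of radius `M`.
  set M := max δ (max M₁ M₂)
  have hδ : 0 < δ := lt_min hδ₁ hδ₂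
  have hδM : δ ≤ M := le_max_left _ _
  have hM : 0 < M := hδ.trans_le hδM
  have h₁ := hu₁.mono (min_le_left δ₁ δ₂) ((le_max_left M₁ M₂).trans (le_max_right δ _))
    (le_max_left C₁ C₂)
  have h₂ := hu₂.mono (min_le_right δ₁ δ₂) ((le_max_right M₁ M₂).trans (le_max_right δ _))
    (le_max_right C₁ C₂)
  refine ⟨fun b α _ => ⟨fun t => RamifiedOrbital.integrable_kernel hψ h₁ h₂ b α t,
    fun χ s hχ hs => RamifiedOrbital.integrable_kernel_mul_twist h hψ h₁ h₂ b α hχ hs⟩,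
    fun r hr => ⟨?_, ?_⟩⟩
  · obtain ⟨A, m, hA⟩ := RamifiedOrbital.exists_orbitalMellin_le (μ := μ) (ν := ν) h hψ ha ha0
      h₁ h₂ hδ hδM hr
    refine ⟨A, m, fun b hb α hα χ s hχ hs => ?_⟩
    have hα0 : α ≠ 0 := by
      rintro rfl
      exact hα.1 rfl
    rw [RamifiedOrbital.majorant, RamifiedOrbital.zpow_minOrd_eq w hα0]
    exact hA b hb α hα0 χ s hχ hs
  · obtain ⟨R, hR⟩ := RamifiedOrbital.exists_innerIntegral_eq_zero (μ := μ) h ha h₁ h₂ hδ hδM r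
    have hq := h.one_lt_cast
    have hq0 := h.cast_pos
    -- With this `k`, every `u` in the `k`-th unit group satisfies `|u - 1| M ≤ δ`.
    obtain ⟨k, hk⟩ := pow_unbounded_of_one_lt (M / δ) hq
    refine ⟨max R ((RamifiedOrbital.q w : ℝ) ^ k), fun b hb α χ s _ _ hlarge => ?_⟩
    have hsmall : R < ‖α‖ → RamifiedOrbital.orbitalMellin μ ν ψ f₁ f₂ b α χ s = 0 := fun hα =>
      RamifiedOrbital.orbitalMellin_eq_zero_of_innerIntegral (fun t => hR b hb α t hα) χ s
    have hnorm := RamifiedOrbital.norm_eq_max α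
    rcases hlarge with hl | hl | hl | hl
    · exact hsmall (((le_max_left _ _).trans_lt hl).trans_le
        (hnorm ▸ (le_max_left _ _).trans (le_max_right _ _)))
    · exact hsmall (((le_max_left _ _).trans_lt hl).trans_le
        (hnorm ▸ (le_max_right _ _).trans (le_max_right _ _)))
    · exact hsmall (((le_max_left _ _).trans_lt hl).trans_le (hnorm ▸ le_max_left _ _))
    · have hlt := (le_max_right R _).trans_lt hl
      rw [RamifiedOrbital.conductorNorm, pow_lt_pow_iff_right₀ hq] at hlt
      -- Since `k` lies below the conductor exponent, `χ` is nontrivial on the `k`-th unit group.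
      have hnot := Nat.notMem_of_lt_sInf hlt
      simp only [Set.mem_ofPred_eq, not_forall] at hnot
      obtain ⟨u, ⟨hu, hu1⟩, hχu⟩ := hnot
      refine RamifiedOrbital.orbitalMellin_eq_zero_of_unit h₁ h₂ b α χ s hu ?_ hχu
      rw [← le_div_iff₀ hM]
      refine hu1.trans ?_
      rw [← inv_div]
      exact inv_anti₀ (by positivity) hk.le
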